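/- Let $r,m,\alpha,\hbar>0$ and let $l$ be an integer or half-integer (of either sign). Let $S^2=\{\mathbf x\in\mathbb R^3: x_1^2+x_2^2+x_3^2=r^2\}$ with surface area measure, and let $S^2_{\mathbb C}=\{\mathbf a\in\mathbb C^3: a_1^2+a_2^2+a_3^2=r^2\}$. Let $E_1=\tfrac12\begin{pmatrix}0&1\\-1&0\end{pmatrix}$, $E_2=\tfrac12\begin{pmatrix}0&i\\i&0\end{pmatrix}$, $E_3=\tfrac12\begin{pmatrix}i&0\\0&-i\end{pmatrix}$ be the usual basis of $\mathrm{su}(2)$. Let $(\Pi,V_{|l|})$ be the irreducible unitary representation of $\mathrm{SU}(2)$ of dimension $2|l|+1$ (realized on the symmetric tensors in $(\mathbb C^2)^{\otimes 2|l|}$), put $\sigma_j=i\hbar\,\frac{d}{dt}\Pi(e^{tE_j})\big|_{t=0}$ (so that the largest eigenvalue of $\sigma_3$ is $\hbar|l|$), and write $\sigma\cdot\mathbf a=\sum_j a_j\sigma_j$ for $\mathbf a\in\mathbb C^3$. The Schrödinger Hilbert space $\Gamma^2(S^2;l)$ is the space of $\psi\in L^2(S^2;V_{|l|})$ such that $(\sigma\cdot\mathbf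 x)\psi(\mathbf x)=r\hbar l\,\psi(\mathbf x)$ for almost every $\mathbf x\in S^2$. Let $\hat J_j=L_j+\sigma_j$, where $L_1=-i\hbar\left(x_2\frac{\partial}{\partial x_3}-x_3\frac{\partial}{\partial x_2}\right)$ and $L_2,L_3$ are obtained by cyclic permutation, and let $\hat J^2=\sum_j\hat J_j^2$, understood as the closure in $L^2(S^2;V_{|l|})$ of this differential operator on smooth functions. For $c>0$, $\Psi=\exp(-c\hat J^2)\psi$ denotes the value $u(1)$ of the solution of $\frac{du}{dt}=-c\hat J^2u$ for $t>0$, $u(0)=\psi$, in $L^2(S^2;V_{|l|})$, where $u$ is continuous on $[0,\infty)$ and, for $t>0$, is differentiable with $u(t)$ in the domain of $\hat J^2$. Proposition (Segal–Bargmann transform). For every $\psi\in\Gamma^2(S^2;l)$ the element $$\Psi=\exp\left\{-\frac{\hat J^2}{2m\alpha r^2\hbar}\right\}\psi$$ exists, is unique, and belongs to $\Gamma^2(S^2;l)$. There is exactly one holomorphic map $S^2_{\mathbb C}\to V_{|l|}$ whose restriction to $S^2$ is equal to $\Psi$ almost everywhere. This extension, again denoted $\Psi$, satisfies $$(\sigma\cdot\mathbf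 a)\Psi(\mathbf a)=r\hbar l\,\Psi(\mathbf a)\qquad\text{for all }\mathbf a\in S^2_{\mathbb C},$$ that is, it is an element of the space $\mathcal H(S^2_{\mathbb C};l)$ of holomorphic sections. -/

import Mathlib

open MeasureTheory Filter Topology
open scoped ContDiff ENNReal InnerProductSpace

noncomputable section

namespace MonopoleSphere

/-! ### The basis of `su(2)` and its one-parameter subgroups -/

/-- The basis `E₁, E₂, E₃` of `su(2)`, with `[E_j, E_k] = ε_{jkl} E_l` (indices `0, 1, 2`). -/
def suBasis : Fin 3 → Matrix (Fin 2) (Fin 2) ℂ :=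
  ![(1 / 2 : ℂ) • !![0, 1; -1, 0],
    (1 / 2 : ℂ) • !![0, Complex.I; Complex.I, 0],
    (1 / 2 : ℂ) • !![Complex.I, 0; 0, -Complex.I]]

theorem suBasis_star (j : Fin 3) : (suBasis j).conjTranspose = -suBasis j := by
  fin_cases j <;> ext a b <;> fin_cases a <;> fin_cases b <;>
    simp [suBasis, Matrix.conjTranspose_apply]

theorem suBasis_transpose (j : Fin 3) :
    !![0, 1; -1, 0] * (suBasis j).transpose * !![0, -1; 1, 0] = -suBasis j := by
  fin_cases j <;> ext a b <;> fin_cases a <;> fin_cases b <;>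
    simp [suBasis, Matrix.mul_apply, Matrix.vecMul, dotProduct, Fin.sum_univ_two]

theorem exp_mem (j : Fin 3) (t : ℝ) :
    NormedSpace.exp (t • suBasis j) ∈ Matrix.specialUnitaryGroup (Fin 2) ℂ := by
  have hinv : NormedSpace.exp (t • suBasis j) * NormedSpace.exp (-(t • suBasis j)) = 1 := by
    rw [← Matrix.exp_add_of_commute _ _ (Commute.neg_right (Commute.refl (t • suBasis j))), add_neg_cancel,
      NormedSpace.exp_zero]
  rw [Matrix.mem_specialUnitaryGroup_iff]
  constructor
  · rw [Matrix.mem_unitaryGroup_iff, Matrix.star_eq_conjTranspose, ← Matrix.exp_conjTranspose,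
      Matrix.conjTranspose_smul, suBasis_star]
    simpa using hinv
  · let J : (Matrix (Fin 2) (Fin 2) ℂ)ˣ :=
      ⟨!![0, 1; -1, 0], !![0, -1; 1, 0], by
        ext a b; fin_cases a <;> fin_cases b <;> simp [Matrix.mul_apply, Fin.sum_univ_two], by
        ext a b; fin_cases a <;> fin_cases b <;> simp [Matrix.mul_apply, Fin.sum_univ_two]⟩
    have h1 := Matrix.exp_units_conj J (t • suBasis j).transpose
    have h2 : (J : Matrix (Fin 2) (Fin 2) ℂ) * (t • suBasis j).transpose *
        (↑J⁻¹ : Matrix (Fin 2) (Fin 2) ℂ) = -(t • suBasis j) := by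
      have := suBasis_transpose j
      rw [Matrix.transpose_smul, Matrix.mul_smul, Matrix.smul_mul]
      change t • (!![0, 1; -1, 0] * (suBasis j).transpose * !![0, -1; 1, 0]) = _
      rw [this, smul_neg]
    rw [h2, Matrix.exp_transpose] at h1
    rw [h1] at hinv
    have h3 := congrFun (congrFun hinv 0) 0
    have hJ : (J : Matrix (Fin 2) (Fin 2) ℂ) = !![0, 1; -1, 0] := rfl
    have hJ' : (↑J⁻¹ : Matrix (Fin 2) (Fin 2) ℂ) = !![0, -1; 1, 0] := rfl
    rw [hJ, hJ'] at h3
    rw [Matrix.det_fin_two]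
    simp [Matrix.mul_apply, Matrix.vecMul, dotProduct, Fin.sum_univ_two] at h3
    linear_combination h3

/-- The one-parameter subgroup `t ↦ e^{t E_j}` of `SU(2)`. -/
def expSU (j : Fin 3) (t : ℝ) : Matrix.specialUnitaryGroup (Fin 2) ℂ :=
  ⟨NormedSpace.exp (t • suBasis j), exp_mem j t⟩

/-! ### The irreducible unitary representations of `SU(2)` -/

/-- The symmetric tensors in `(ℂ²)^{⊗ n}`. A tensor is given by its components with respect to
the standard basis, indexed by `Fin n → Fin 2`. -/
def SymTensor (n : ℕ) : Submodule ℂ (EuclideanSpace ℂ (Fin n → Fin 2)) where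
  carrier := {v | ∀ (p : Equiv.Perm (Fin n)) (i : Fin n → Fin 2), v (i ∘ p) = v i}
  zero_mem' := by intro p i; simp
  add_mem' := by intro v w hv hw p i; simp [hv p i, hw p i]
  smul_mem' := by intro c v hv p i; simp [hv p i]

/-- The space `V` of the irreducible representation of `SU(2)` of spin `n / 2`: the space of
symmetric tensors in `(ℂ²)^{⊗ n}`, with the inner product of `(ℂ²)^{⊗ n}`. -/
def Spin (n : ℕ) : Type := SymTensor n

instance (n : ℕ) : NormedAddCommGroup (Spin n) :=
  inferInstanceAs (NormedAddCommGroup (SymTensor n))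

instance (n : ℕ) : InnerProductSpace ℂ (Spin n) :=
  inferInstanceAs (InnerProductSpace ℂ (SymTensor n))

instance (n : ℕ) : FiniteDimensional ℂ (Spin n) :=
  inferInstanceAs (FiniteDimensional ℂ (SymTensor n))

/-- The matrix of `M ⊗ ⋯ ⊗ M` (`n` factors). -/
def tensorPow (n : ℕ) (M : Matrix (Fin 2) (Fin 2) ℂ) :
    Matrix (Fin n → Fin 2) (Fin n → Fin 2) ℂ :=
  Matrix.of fun i j => ∏ s, M (i s) (j s)

theorem tensorPow_one (n : ℕ) : tensorPow n 1 = 1 := by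
  ext i j
  by_cases h : i = j
  · subst h; simp [tensorPow]
  · obtain ⟨s, hs⟩ := Function.ne_iff.1 h
    rw [Matrix.one_apply_ne h]
    exact Finset.prod_eq_zero (Finset.mem_univ s) (Matrix.one_apply_ne hs)

theorem tensorPow_mul (n : ℕ) (M N : Matrix (Fin 2) (Fin 2) ℂ) :
    tensorPow n (M * N) = tensorPow n M * tensorPow n N := by
  ext i j
  simp only [tensorPow, Matrix.of_apply, Matrix.mul_apply, ← Finset.prod_mul_distrib]
  rw [Finset.prod_univ_sum, Fintype.piFinset_univ]

theorem tensorPow_star (n : ℕ) (M : Matrix (Fin 2) (Fin 2) ℂ) :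
    tensorPow n (star M) = star (tensorPow n M) := by
  ext i j
  simp [tensorPow, Matrix.star_apply]

theorem tensorPow_mem (n : ℕ) (M : Matrix (Fin 2) (Fin 2) ℂ)
    (v : EuclideanSpace ℂ (Fin n → Fin 2)) (hv : v ∈ SymTensor n) :
    Matrix.toEuclideanCLM (n := Fin n → Fin 2) (𝕜 := ℂ) (tensorPow n M) v ∈ SymTensor n := by
  intro p i
  change (tensorPow n M).mulVec v.ofLp (i ∘ p) = (tensorPow n M).mulVec v.ofLp i
  simp only [Matrix.mulVec, dotProduct, tensorPow, Matrix.of_apply]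
  rw [← Equiv.sum_comp (Equiv.arrowCongr p.symm (Equiv.refl (Fin 2)))]
  refine Finset.sum_congr rfl fun j _ => ?_
  have h1 : (Equiv.arrowCongr p.symm (Equiv.refl (Fin 2))) j = j ∘ p := by
    ext s; simp
  rw [h1, hv p j, ← Equiv.prod_comp p (fun s => M (i s) (j s))]
  rfl

/-- The restriction of `M ⊗ ⋯ ⊗ M` (`n` factors) to the symmetric tensors. -/
def symPow (n : ℕ) (M : Matrix (Fin 2) (Fin 2) ℂ) : Spin n →L[ℂ] Spin n :=
  (((Matrix.toEuclideanCLM (n := Fin n → Fin 2) (𝕜 := ℂ) (tensorPow n M)).comp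
    (SymTensor n).subtypeL).codRestrict (SymTensor n) fun v => tensorPow_mem n M v v.2 :
    SymTensor n →L[ℂ] SymTensor n)

theorem symPow_val (n : ℕ) (M : Matrix (Fin 2) (Fin 2) ℂ) (v : Spin n) :
    (symPow n M v).val =
      Matrix.toEuclideanCLM (n := Fin n → Fin 2) (𝕜 := ℂ) (tensorPow n M) v.val :=
  rfl

/-- The representation `Π` of `SU(2)` of spin `n / 2`. -/
def spinRep (n : ℕ) : Matrix.specialUnitaryGroup (Fin 2) ℂ →* (Spin n →L[ℂ] Spin n) where
  toFun U := symPow n U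
  map_one' := by
    refine ContinuousLinearMap.ext fun v => Subtype.ext ?_
    rw [symPow_val, Submonoid.coe_one, tensorPow_one, map_one]
    rfl
  map_mul' U W := by
    refine ContinuousLinearMap.ext fun v => Subtype.ext ?_
    rw [symPow_val, Submonoid.coe_mul, tensorPow_mul, map_mul]
    rfl

/-- The representation `Π` is unitary. -/
theorem norm_spinRep (n : ℕ) (U : Matrix.specialUnitaryGroup (Fin 2) ℂ) (v : Spin n) :
    ‖spinRep n U v‖ = ‖v‖ := by
  have hU : star (tensorPow n U) * tensorPow n U = 1 := by
    rw [← tensorPow_star, ← tensorPow_mul,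
      Matrix.mem_unitaryGroup_iff'.1 (Matrix.mem_specialUnitaryGroup_iff.1 U.2).1, tensorPow_one]
  have hT : Matrix.toEuclideanCLM (n := Fin n → Fin 2) (𝕜 := ℂ) (tensorPow n U) ∈
      unitary (EuclideanSpace ℂ (Fin n → Fin 2) →L[ℂ] EuclideanSpace ℂ (Fin n → Fin 2)) := by
    rw [Unitary.mem_iff, ← map_star, ← map_mul, ← map_mul, hU, mul_eq_one_comm.1 hU, map_one]
    exact ⟨rfl, rfl⟩
  exact ContinuousLinearMap.norm_map_of_mem_unitary hT v.val

/-- `σ_j = i ħ d/dt Π(e^{t E_j})` at `t = 0`. -/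
def sigma (ħ : ℝ) (n : ℕ) (j : Fin 3) : Spin n →L[ℂ] Spin n :=
  (Complex.I * (ħ : ℂ)) • deriv (fun t : ℝ => spinRep n (expSU j t)) 0

/-- `σ · a = a₁ σ₁ + a₂ σ₂ + a₃ σ₃` for `a ∈ ℂ³`. -/
def sigmaDot (ħ : ℝ) (n : ℕ) (a : Fin 3 → ℂ) : Spin n →L[ℂ] Spin n :=
  ∑ j, a j • sigma ħ n j

/-! ### The sphere and the Schrödinger Hilbert space -/

/-- Euclidean space `ℝ³`. -/
abbrev E3 : Type := EuclideanSpace ℝ (Fin 3)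

/-- The sphere `S²` of radius `r` in `ℝ³`. -/
abbrev RealSphere (r : ℝ) : Type := Metric.sphere (0 : E3) r

/-- The surface area measure on the sphere of radius `r > 0`: the surface measure of the unit
sphere, transported by `u ↦ r u` and multiplied by `r²`. -/
def surfaceMeasure (r : ℝ) : Measure (RealSphere r) :=
  ENNReal.ofReal (r ^ 2) •
    ((Measure.map (fun u : Metric.sphere (0 : E3) 1 => r • (u : E3))
      (volume : Measure E3).toSphere).comap (Subtype.val : RealSphere r → E3))

/-- The Hilbert space `L²(S²; V)`, where `V` has spin `n / 2`. -/
abbrev L2 (r : ℝ) (n : ℕ) : Type := Lp (Spin n) 2 (surfaceMeasure r)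

/-- The real point `x`, regarded as a point of `ℂ³`. -/
def toComplex (x : E3) : Fin 3 → ℂ := fun j => (x j : ℂ)

/-- The Schrödinger Hilbert space `Γ²(S²; l)` for `l = k / 2`: the subspace of `ψ` in
`L²(S²; V_{|l|})` with `(σ · x) ψ(x) = r ħ l ψ(x)`. -/
def Schrodinger (r ħ : ℝ) (k : ℤ) : Submodule ℂ (L2 r k.natAbs) where
  carrier := {ψ | ∀ᵐ x : RealSphere r ∂surfaceMeasure r,
    sigmaDot ħ k.natAbs (toComplex x.1) (ψ x) = ((r * ħ * (k / 2) : ℝ) : ℂ) • ψ x}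
  zero_mem' := by
    filter_upwards [Lp.coeFn_zero (Spin k.natAbs) 2 (surfaceMeasure r)] with x hx
    rw [hx, Pi.zero_apply, map_zero, smul_zero]
  add_mem' := by
    intro φ ψ hφ hψ
    filter_upwards [hφ, hψ, Lp.coeFn_add φ ψ] with x h1 h2 h3
    simp only [h3, Pi.add_apply, map_add, h1, h2, smul_add]
  smul_mem' := by
    intro c ψ hψ
    filter_upwards [hψ, Lp.coeFn_smul c ψ] with x h1 h2
    simp only [h2, Pi.smul_apply, map_smul, h1]
    rw [smul_comm]

/-! ### The angular momentum operators and the heat operator -/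

/-- The partial derivative `∂ f / ∂ x_i`. -/
def partialDeriv {n : ℕ} (i : Fin 3) (f : E3 → Spin n) (x : E3) : Spin n :=
  fderiv ℝ f x (EuclideanSpace.single i 1)

/-- `L₁ f = -i ħ (x₂ ∂f/∂x₃ - x₃ ∂f/∂x₂)` and its cyclic permutations. -/
def orbital (ħ : ℝ) {n : ℕ} (j : Fin 3) (f : E3 → Spin n) (x : E3) : Spin n :=
  (-Complex.I * (ħ : ℂ)) • (((x (j + 1) : ℝ) : ℂ) • partialDeriv (j + 2) f x
    - ((x (j + 2) : ℝ) : ℂ) • partialDeriv (j + 1) f x)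

/-- `Ĵ_j = L_j + σ_j`. The operator is tangential to the spheres centred at the origin, so the
restriction of `Ĵ_j f` to a sphere depends only on the restriction of `f`. -/
def angular (ħ : ℝ) {n : ℕ} (j : Fin 3) (f : E3 → Spin n) (x : E3) : Spin n :=
  orbital ħ j f x + sigma ħ n j (f x)

/-- `Ĵ² = Ĵ₁² + Ĵ₂² + Ĵ₃²`. -/
def angularSq (ħ : ℝ) {n : ℕ} (f : E3 → Spin n) (x : E3) : Spin n :=
  ∑ j, angular ħ j (angular ħ j f) x

/-- The graph of `Ĵ²` on the smooth functions `S² → V` (that is, on the restrictions to `S²` of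
smooth functions on `ℝ³`), as a subset of `L² × L²`. -/
def smoothGraph (r ħ : ℝ) (n : ℕ) : Set (L2 r n × L2 r n) :=
  {p | ∃ f : E3 → Spin n, ContDiff ℝ ∞ f ∧
    (∀ᵐ x ∂surfaceMeasure r, p.1 x = f x) ∧
    (∀ᵐ x ∂surfaceMeasure r, p.2 x = angularSq ħ f x)}

/-- The graph of the self-adjoint operator `Ĵ²` on `L²(S²; V)`: the closure of `Ĵ²` on the smooth
functions. -/
def angularSqGraph (r ħ : ℝ) (n : ℕ) : Set (L2 r n × L2 r n) :=
  closure (smoothGraph r ħ n)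

/-- `Ψ = exp(-c Ĵ²) ψ`: there is a solution `u` of the heat equation `du/dt = -c Ĵ² u` in
`L²(S²; V)`, continuous for `t ≥ 0` and differentiable, with values in the domain of `Ĵ²`, for
`t > 0`, which has the initial value `u(0) = ψ` and satisfies `u(1) = Ψ`. -/
def IsExpNegAngularSq (r ħ c : ℝ) {n : ℕ} (ψ Ψ : L2 r n) : Prop :=
  ∃ u : ℝ → L2 r n, ContinuousOn u (Set.Ici 0) ∧ u 0 = ψ ∧ u 1 = Ψ ∧
    ∀ t : ℝ, 0 < t → ∃ w : L2 r n, (u t, w) ∈ angularSqGraph r ħ n ∧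
      HasDerivAt u (-((c : ℂ) • w)) t

/-! ### The complex sphere and its holomorphic sections -/

/-- The complex sphere `a₁² + a₂² + a₃² = r²` in `ℂ³`. -/
def complexSphere (r : ℝ) : Set (Fin 3 → ℂ) :=
  {a | a 0 ^ 2 + a 1 ^ 2 + a 2 ^ 2 = (r : ℂ) ^ 2}

/-- The inclusion of the real sphere in the complex sphere. -/
def inclusion {r : ℝ} (x : RealSphere r) : complexSphere r :=
  ⟨toComplex x, by
    have h1 : ‖(x : E3)‖ = r := mem_sphere_zero_iff_norm.1 x.2
    have h2 := EuclideanSpace.norm_sq_eq (x : E3)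
    rw [h1, Fin.sum_univ_three] at h2
    simp only [Real.norm_eq_abs, sq_abs] at h2
    change ((x : E3) 0 : ℂ) ^ 2 + ((x : E3) 1 : ℂ) ^ 2 + ((x : E3) 2 : ℂ) ^ 2 = (r : ℂ) ^ 2
    exact_mod_cast h2.symm⟩

/-- Holomorphic maps from the complex sphere, a closed complex submanifold of `ℂ³`, to `V`: those
which near each point are restrictions of holomorphic maps on open subsets of `ℂ³`. -/
def IsHolomorphic {r : ℝ} {n : ℕ} (F : complexSphere r → Spin n) : Prop :=
  ∀ a : complexSphere r, ∃ U : Set (Fin 3 → ℂ), IsOpen U ∧ (a : Fin 3 → ℂ) ∈ U ∧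
    ∃ G : (Fin 3 → ℂ) → Spin n, DifferentiableOn ℂ G U ∧
      ∀ b : complexSphere r, (b : Fin 3 → ℂ) ∈ U → F b = G b

/-- The space `ℋ(S²_ℂ; l)` of holomorphic sections, for `l = k / 2`. -/
def HolomorphicSections (r ħ : ℝ) (k : ℤ) : Set (complexSphere r → Spin k.natAbs) :=
  {F | IsHolomorphic F ∧ ∀ a : complexSphere r,
    sigmaDot ħ k.natAbs a (F a) = ((r * ħ * (k / 2) : ℝ) : ℂ) • F a}

/-- `F` is a holomorphic extension of the section `Ψ` from `S²` to the complex sphere. -/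
def IsHolomorphicExtension {r : ℝ} {n : ℕ} (Ψ : L2 r n) (F : complexSphere r → Spin n) : Prop :=
  IsHolomorphic F ∧ ∀ᵐ x ∂surfaceMeasure r, F (inclusion x) = Ψ x

end MonopoleSphere

end

open MonopoleSphere

noncomputable section

namespace MonopoleSphere

/-! ### The spin operators -/

section SpinOperators

open scoped Matrix.Norms.Operator

/-! The operator `Ĵ²` is symmetric on smooth functions and preserves the finite-dimensional spaces
of polynomials of bounded degree. By Stone–Weierstrass the polynomials are dense in `L²`, so `L²`
has a Hilbert basis of polynomial eigenfunctions, grouped by degree `d` (`exists_eigenbasis`). Up to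
lower degree `∑ L_j²` acts in degree `d` as `ħ² d (d + 1)`, and `Ĵ_j - L_j` is bounded, so the
eigenvalues satisfy `λ ≥ ħ² d (d + 1) / 2 - C` (`le_eigenvalue`).

In this basis the heat equation decouples into scalar equations, which gives existence
(`HilbertBasis.exists_heat`) and uniqueness (`HilbertBasis.heat_coeff`): each coefficient of `ψ` is
multiplied by `exp(-cλ)`. Multiplication by `σ · x` is rotation invariant, hence commutes with every
`Ĵ_j` and maps solutions to solutions; by uniqueness the flow preserves the eigenvalue equation
defining `Γ²(S²; l)`.

For the extension, every point of the complex sphere lies on a great circle with complex angle, on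
which a polynomial of degree `d` is a trigonometric polynomial. The maximum principle bounds it by
`exp(d |Im θ|)` times its real supremum, and a derivative estimate bounds that supremum by the `L²`
norm up to a factor geometric in `d` (`exists_extension_bound`). The degree-`d` part of `Ψ` has norm
of order `exp(-c ħ² d² / 2)`, which beats every geometric factor, so the series of extensions
converges to a holomorphic map. The identity theorem along great circles (`IsHolomorphic.ext_ae`)
gives uniqueness and carries the equation for `σ · x` to the complex sphere. -/

instance (n : ℕ) : CompleteSpace (Spin n) := FiniteDimensional.complete ℂ (Spin n)

/-- The compression of an operator on `(ℂ²)^{⊗ n}` to the symmetric tensors. -/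
def compression (n : ℕ) :
    Matrix (Fin n → Fin 2) (Fin n → Fin 2) ℂ →ₗ[ℂ] (Spin n →L[ℂ] Spin n) where
  toFun A := (((SymTensor n).orthogonalProjectionOnto.comp
    ((Matrix.toEuclideanCLM (n := Fin n → Fin 2) (𝕜 := ℂ) A).comp (SymTensor n).subtypeL) :
    SymTensor n →L[ℂ] SymTensor n))
  map_add' A B := by
    rw [map_add, ContinuousLinearMap.add_comp, ContinuousLinearMap.comp_add]; rfl
  map_smul' c A := by
    rw [map_smul, ContinuousLinearMap.smul_comp, ContinuousLinearMap.comp_smul]; rfl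

theorem compression_tensorPow (n : ℕ) (M : Matrix (Fin 2) (Fin 2) ℂ) :
    compression n (tensorPow n M) = symPow n M := by
  refine ContinuousLinearMap.ext fun v => ?_
  exact Submodule.orthogonalProjectionOnto_mem_subspace_eq_self
    (K := SymTensor n) ⟨_, tensorPow_mem n M v.1 v.2⟩

/-- Compression is linear in the matrix, so `symPow n M` is a combination of fixed operators whose
coefficients are monomials in the entries of `M`. -/
theorem differentiable_symPow (n : ℕ) : Differentiable ℝ (symPow n) := by
  have h : symPow n = fun M => ∑ i, ∑ j, (∏ s, M (i s) (j s)) •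
      compression n (Matrix.single i j 1) := by
    funext M
    rw [← compression_tensorPow]
    conv_lhs => rw [Matrix.matrix_eq_sum_single (tensorPow n M)]
    simp only [map_sum]
    refine Finset.sum_congr rfl fun i _ => Finset.sum_congr rfl fun j _ => ?_
    rw [← map_smul, Matrix.smul_single, smul_eq_mul, mul_one]; rfl
  rw [h]
  refine Differentiable.fun_sum fun i _ => Differentiable.fun_sum fun j _ => ?_
  refine Differentiable.smul_const ?_ _
  fun_prop

theorem symPow_mul (n : ℕ) (M N : Matrix (Fin 2) (Fin 2) ℂ) :
    symPow n (M * N) = symPow n M * symPow n N := by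
  refine ContinuousLinearMap.ext fun v => Subtype.ext ?_
  rw [symPow_val, tensorPow_mul, map_mul]
  rfl

theorem symPow_one (n : ℕ) : symPow n 1 = 1 := by
  refine ContinuousLinearMap.ext fun v => Subtype.ext ?_
  rw [symPow_val, tensorPow_one, map_one]
  rfl

/-- The representation of the Lie algebra of all matrices on the symmetric tensors. -/
def liePow (n : ℕ) : Matrix (Fin 2) (Fin 2) ℂ →L[ℝ] (Spin n →L[ℂ] Spin n) :=
  fderiv ℝ (symPow n) 1

theorem hasDerivAt_exp_smul (X : Matrix (Fin 2) (Fin 2) ℂ) :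
    HasDerivAt (fun t : ℝ => NormedSpace.exp (t • X)) X 0 := by
  have h := hasDerivAt_exp_smul_const (𝕂 := ℝ) X 0
  rw [zero_smul, NormedSpace.exp_zero, one_mul] at h
  exact h

theorem hasDerivAt_symPow {g : ℝ → Matrix (Fin 2) (Fin 2) ℂ} {X : Matrix (Fin 2) (Fin 2) ℂ}
    (n : ℕ) (hg : HasDerivAt g X 0) (h1 : g 0 = 1) :
    HasDerivAt (fun t => symPow n (g t)) (liePow n X) 0 := by
  have h : HasFDerivAt (symPow n) (liePow n) (g 0) := by
    rw [h1]; exact (differentiable_symPow n 1).hasFDerivAt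
  exact h.comp_hasDerivAt 0 hg

theorem sigma_eq (ħ : ℝ) (n : ℕ) (j : Fin 3) :
    sigma ħ n j = (Complex.I * (ħ : ℂ)) • liePow n (suBasis j) := by
  have h := hasDerivAt_symPow n (hasDerivAt_exp_smul (suBasis j)) (by simp)
  rw [sigma]
  congr 1
  exact h.deriv

/-- Differentiate the multiplicativity of `symPow` along `g e^{tY} g'` at `t = 0`; the relation `g
g' = 1` makes this curve start at the identity. -/
theorem symPow_conj_liePow (n : ℕ) {g g' : Matrix (Fin 2) (Fin 2) ℂ} (hg : g * g' = 1)
    (Y : Matrix (Fin 2) (Fin 2) ℂ) :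
    symPow n g * liePow n Y * symPow n g' = liePow n (g * Y * g') := by
  have h1 : HasDerivAt (fun t : ℝ => symPow n g * symPow n (NormedSpace.exp (t • Y)) * symPow n g')
      (symPow n g * liePow n Y * symPow n g') 0 :=
    (((hasDerivAt_symPow n (hasDerivAt_exp_smul Y) (by simp)).const_mul _).mul_const _)
  have h2 : HasDerivAt (fun t : ℝ => symPow n (g * NormedSpace.exp (t • Y) * g'))
      (liePow n (g * Y * g')) 0 :=
    hasDerivAt_symPow n (((hasDerivAt_exp_smul Y).const_mul g).mul_const g') (by simp [hg])
  simp only [symPow_mul] at h2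
  exact h1.unique h2

/-- This is the derivative at `t = 0` of `symPow_conj_liePow` with `g = e^{tX}` and `g' = e^{-tX}`.
-/
theorem liePow_commutator (n : ℕ) (X Y : Matrix (Fin 2) (Fin 2) ℂ) :
    liePow n X * liePow n Y - liePow n Y * liePow n X = liePow n (X * Y - Y * X) := by
  have hX := hasDerivAt_exp_smul X
  have hX' : HasDerivAt (fun t : ℝ => NormedSpace.exp (t • (-X))) (-X) 0 :=
    hasDerivAt_exp_smul (-X)
  have hinv : ∀ t : ℝ, NormedSpace.exp (t • X) * NormedSpace.exp (t • (-X)) = 1 := fun t => by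
    rw [smul_neg, ← Matrix.exp_add_of_commute _ _ (Commute.neg_right (Commute.refl (t • X))),
      add_neg_cancel, NormedSpace.exp_zero]
  have h1 := ((hasDerivAt_symPow n hX (by simp)).mul_const (liePow n Y)).mul
    (hasDerivAt_symPow n hX' (by simp))
  have h2 := (liePow n).hasFDerivAt.comp_hasDerivAt (0 : ℝ) ((hX.mul_const Y).mul hX')
  have h3 : (fun t : ℝ => liePow n
      (NormedSpace.exp (t • X) * Y * NormedSpace.exp (t • (-X)))) =
      fun t => symPow n (NormedSpace.exp (t • X)) * liePow n Y *
        symPow n (NormedSpace.exp (t • (-X))) := by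
    funext t; rw [symPow_conj_liePow n (hinv t)]
  have h4 := h1.unique (h2.congr_of_eventuallyEq (Eventually.of_forall fun t => (congrFun h3 t).symm))
  simp only [zero_smul, NormedSpace.exp_zero, symPow_one, mul_one, one_mul, map_neg, mul_neg,
    ← sub_eq_add_neg] at h4
  exact h4

theorem suBasis_commutator (j : Fin 3) :
    suBasis j * suBasis (j + 1) - suBasis (j + 1) * suBasis j = suBasis (j + 2) := by
  fin_cases j <;> ext a b <;> fin_cases a <;> fin_cases b <;>
    simp [suBasis] <;> ring_nf <;> simp <;> ring

theorem sigma_commutator (ħ : ℝ) (n : ℕ) (j : Fin 3) :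
    sigma ħ n j * sigma ħ n (j + 1) - sigma ħ n (j + 1) * sigma ħ n j =
      (Complex.I * (ħ : ℂ)) • sigma ħ n (j + 2) := by
  rw [sigma_eq, sigma_eq, sigma_eq, ← suBasis_commutator, ← liePow_commutator]
  simp only [smul_mul_assoc, mul_smul_comm, smul_sub]

/-- Unitarity makes `⟪Π(e^{tE_j}) v, Π(e^{tE_j}) w⟫` constant in `t`; its derivative says that
`dΠ(E_j)` is skew, and the factor `i ħ` turns skew into symmetric. -/
theorem inner_sigma (ħ : ℝ) (n : ℕ) (j : Fin 3) (v w : Spin n) :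
    ⟪sigma ħ n j v, w⟫_ℂ = ⟪v, sigma ħ n j w⟫_ℂ := by
  have h := hasDerivAt_symPow n (hasDerivAt_exp_smul (suBasis j)) (by simp)
  have ha : ∀ u : Spin n, HasDerivAt (fun t : ℝ => symPow n (NormedSpace.exp (t • suBasis j)) u)
      (liePow n (suBasis j) u) 0 := fun u => by
    exact ((ContinuousLinearMap.apply ℂ (Spin n) u).restrictScalars ℝ).hasFDerivAt.comp_hasDerivAt
      (0 : ℝ) h
  have hu : ∀ t : ℝ, ⟪symPow n (NormedSpace.exp (t • suBasis j)) v,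
      symPow n (NormedSpace.exp (t • suBasis j)) w⟫_ℂ = ⟪v, w⟫_ℂ := fun t =>
    LinearIsometry.inner_map_map
      ⟨(symPow n (NormedSpace.exp (t • suBasis j))).toLinearMap,
        fun x => norm_spinRep n (expSU j t) x⟩ v w
  have h2 := (ha v).inner ℂ (ha w)
  simp only [hu, zero_smul, NormedSpace.exp_zero, symPow_one, one_apply_eq_self] at h2
  have h3 := h2.unique (hasDerivAt_const (0 : ℝ) ⟪v, w⟫_ℂ)
  rw [sigma_eq]
  simp only [smul_apply, inner_smul_left, inner_smul_right, map_mul,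
    Complex.conj_I, Complex.conj_ofReal]
  linear_combination (-Complex.I * ħ) * h3

end SpinOperators

end MonopoleSphere

namespace MonopoleSphere

/-! ### Operators on smooth functions -/

section SmoothFunctions

variable {n : ℕ}

theorem contDiff_coord (k : Fin 3) : ContDiff ℝ ∞ fun x : E3 => ((x k : ℝ) : ℂ) := by
  have h : ContDiff ℝ ∞ fun x : E3 => x k := by fun_prop
  exact Complex.ofRealCLM.contDiff.comp h

/-- The smooth functions `ℝ³ → V`. -/
def SmoothFun (n : ℕ) : Submodule ℂ (E3 → Spin n) where
  carrier := {f | ContDiff ℝ ∞ f}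
  zero_mem' := show ContDiff ℝ ∞ fun _ : E3 => (0 : Spin n) from contDiff_const
  add_mem' := fun {f g} (hf : ContDiff ℝ ∞ f) (hg : ContDiff ℝ ∞ g) =>
    show ContDiff ℝ ∞ (f + g) from hf.add hg
  smul_mem' := fun c f (hf : ContDiff ℝ ∞ f) =>
    show ContDiff ℝ ∞ (c • f) from contDiff_const.smul hf

theorem SmoothFun.contDiff (f : SmoothFun n) : ContDiff ℝ ∞ f.1 := f.2

theorem mem_smoothFun {f : E3 → Spin n} (hf : ContDiff ℝ ∞ f) : f ∈ SmoothFun n := hf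

/-- Multiplication by the coordinate `x_k`. -/
def mulX (k : Fin 3) : SmoothFun n →ₗ[ℂ] SmoothFun n where
  toFun f := ⟨fun x => ((x k : ℝ) : ℂ) • f.1 x,
    mem_smoothFun ((contDiff_coord k).smul (SmoothFun.contDiff f))⟩
  map_add' f g := Subtype.ext (funext fun x => smul_add ((x k : ℝ) : ℂ) (f.1 x) (g.1 x))
  map_smul' c f := Subtype.ext (funext fun x => smul_comm ((x k : ℝ) : ℂ) c (f.1 x))

theorem SmoothFun.differentiable (f : SmoothFun n) : Differentiable ℝ f.1 :=
  (SmoothFun.contDiff f).differentiable (by simp)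

theorem contDiff_partialDeriv (k : Fin 3) (f : SmoothFun n) :
    ContDiff ℝ ∞ (partialDeriv k f.1) :=
  (ContDiff.fderiv_right (m := ∞) (SmoothFun.contDiff f) (by simp)).clm_apply contDiff_const

/-- The partial derivative `∂ / ∂ x_k`. -/
def parD (k : Fin 3) : SmoothFun n →ₗ[ℂ] SmoothFun n where
  toFun f := ⟨partialDeriv k f.1, mem_smoothFun (contDiff_partialDeriv k f)⟩
  map_add' f g := Subtype.ext <| funext fun x => by
    change fderiv ℝ (f.1 + g.1) x _ = fderiv ℝ f.1 x _ + fderiv ℝ g.1 x _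
    rw [fderiv_add ((SmoothFun.differentiable f) x) ((SmoothFun.differentiable g) x)]; rfl
  map_smul' c f := Subtype.ext <| funext fun x => by
    change fderiv ℝ (c • f.1) x _ = c • fderiv ℝ f.1 x _
    rw [fderiv_const_smul ((SmoothFun.differentiable f) x)]; rfl

/-- The pointwise action of an operator on `V`. -/
def spinOp (A : Spin n →L[ℂ] Spin n) : SmoothFun n →ₗ[ℂ] SmoothFun n where
  toFun f := ⟨fun x => A (f.1 x), mem_smoothFun
    ((A.restrictScalars ℝ).contDiff.comp (SmoothFun.contDiff f))⟩
  map_add' f g := Subtype.ext (funext fun x => map_add A (f.1 x) (g.1 x))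
  map_smul' c f := Subtype.ext (funext fun x => map_smul A c (f.1 x))

/-- The constant functions. -/
def constFun : Spin n →ₗ[ℂ] SmoothFun n where
  toFun v := ⟨fun _ => v, mem_smoothFun contDiff_const⟩
  map_add' _ _ := rfl
  map_smul' _ _ := rfl

@[simp] theorem mulX_apply (k : Fin 3) (f : SmoothFun n) (x : E3) :
    (mulX k f).1 x = ((x k : ℝ) : ℂ) • f.1 x := rfl

@[simp] theorem spinOp_apply (A : Spin n →L[ℂ] Spin n) (f : SmoothFun n) (x : E3) :
    (spinOp A f).1 x = A (f.1 x) := rfl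

theorem parD_mulX (i k : Fin 3) (f : SmoothFun n) :
    parD i (mulX k f) = (if i = k then (1 : ℂ) else 0) • f + mulX k (parD i f) := by
  refine Subtype.ext <| funext fun x => ?_
  change fderiv ℝ (fun y : E3 => ((y k : ℝ) : ℂ) • f.1 y) x (EuclideanSpace.single i 1) =
    (if i = k then (1 : ℂ) else 0) • f.1 x +
      ((x k : ℝ) : ℂ) • fderiv ℝ f.1 x (EuclideanSpace.single i 1)
  have h1 : HasFDerivAt (fun y : E3 => ((y k : ℝ) : ℂ))
      (Complex.ofRealCLM.comp (EuclideanSpace.proj k : E3 →L[ℝ] ℝ)) x :=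
    (Complex.ofRealCLM.comp (EuclideanSpace.proj k : E3 →L[ℝ] ℝ)).hasFDerivAt
  rw [(h1.fun_smul ((SmoothFun.differentiable f) x).hasFDerivAt).fderiv]
  by_cases h : i = k
  · subst h; simp [add_comm]
  · simp [h, Ne.symm h]

theorem parD_comm (i k : Fin 3) (f : SmoothFun n) : parD i (parD k f) = parD k (parD i f) := by
  refine Subtype.ext <| funext fun x => ?_
  have hs : IsSymmSndFDerivAt ℝ f.1 x :=
    ContDiffAt.isSymmSndFDerivAt (contDiff_infty.1 (SmoothFun.contDiff f) 2).contDiffAt (by simp)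
  have hd : DifferentiableAt ℝ (fderiv ℝ f.1) x :=
    (ContDiff.fderiv_right (m := ∞) (SmoothFun.contDiff f) (by simp)).differentiable (by simp) x
  have h2 : ∀ a b : Fin 3, (parD a (parD b f)).1 x =
      fderiv ℝ (fderiv ℝ f.1) x (EuclideanSpace.single a 1) (EuclideanSpace.single b 1) :=
    fun a b => by
      change fderiv ℝ (fun y => fderiv ℝ f.1 y (EuclideanSpace.single b 1)) x
        (EuclideanSpace.single a 1) = _
      rw [fderiv_clm_apply hd (differentiableAt_const _)]
      simp
  rw [h2, h2]
  exact hs _ _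

theorem parD_spinOp (A : Spin n →L[ℂ] Spin n) (k : Fin 3) (f : SmoothFun n) :
    parD k (spinOp A f) = spinOp A (parD k f) := by
  refine Subtype.ext <| funext fun x => ?_
  change fderiv ℝ ((A.restrictScalars ℝ) ∘ f.1) x _ = A (fderiv ℝ f.1 x _)
  rw [((A.restrictScalars ℝ).hasFDerivAt.comp x ((SmoothFun.differentiable f) x).hasFDerivAt).fderiv]
  rfl

theorem parD_constFun (k : Fin 3) (v : Spin n) : parD k (constFun v) = 0 := by
  refine Subtype.ext <| funext fun x => ?_
  change fderiv ℝ (fun _ : E3 => v) x _ = 0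
  simp

theorem mulX_spinOp (A : Spin n →L[ℂ] Spin n) (k : Fin 3) (f : SmoothFun n) :
    mulX k (spinOp A f) = spinOp A (mulX k f) :=
  Subtype.ext (funext fun x => (map_smul A ((x k : ℝ) : ℂ) (f.1 x)).symm)

/-- The orbital angular momentum `L_j`. -/
def orbitalOp (ħ : ℝ) (j : Fin 3) : SmoothFun n →ₗ[ℂ] SmoothFun n :=
  (-Complex.I * (ħ : ℂ)) • (mulX (j + 1) ∘ₗ parD (j + 2) - mulX (j + 2) ∘ₗ parD (j + 1))

/-- The total angular momentum `Ĵ_j`. -/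
def angularOp (ħ : ℝ) (j : Fin 3) : SmoothFun n →ₗ[ℂ] SmoothFun n :=
  orbitalOp ħ j + spinOp (sigma ħ n j)

/-- The square `Ĵ²` of the total angular momentum. -/
def angularSqOp (ħ : ℝ) : SmoothFun n →ₗ[ℂ] SmoothFun n :=
  ∑ j, angularOp ħ j ∘ₗ angularOp ħ j

theorem angularOp_val (ħ : ℝ) (j : Fin 3) (f : SmoothFun n) :
    (angularOp ħ j f).1 = angular ħ j f.1 := rfl

theorem angularSqOp_val (ħ : ℝ) (f : SmoothFun n) :
    (angularSqOp ħ f).1 = angularSq ħ f.1 := by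
  funext x
  simp only [angularSqOp, LinearMap.coe_sum, Finset.sum_apply, LinearMap.comp_apply,
    Submodule.coe_sum, angularSq, angularOp_val]

/-- The Euler operator `∑ x_k ∂ / ∂ x_k`. -/
def eulerOp : SmoothFun n →ₗ[ℂ] SmoothFun n := ∑ k, mulX k ∘ₗ parD k

/-- The Laplace operator. -/
def laplaceOp : SmoothFun n →ₗ[ℂ] SmoothFun n := ∑ k, parD k ∘ₗ parD k

/-- Multiplication by `|x|²`. -/
def normSqOp : SmoothFun n →ₗ[ℂ] SmoothFun n := ∑ k, mulX k ∘ₗ mulX k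

/-- Multiplication by `σ · x`. -/
def sigmaX (ħ : ℝ) : SmoothFun n →ₗ[ℂ] SmoothFun n :=
  ∑ k, mulX k ∘ₗ spinOp (sigma ħ n k)

theorem orbitalOp_sq (ħ : ℝ) (f : SmoothFun n) :
    ∑ j, orbitalOp ħ j (orbitalOp ħ j f) =
      ((ħ : ℂ) ^ 2) • (eulerOp (eulerOp f) + eulerOp f - normSqOp (laplaceOp f)) := by
  have h10 : parD (1 : Fin 3) (parD 0 f) = parD 0 (parD 1 f) := parD_comm _ _ _
  have h20 : parD (2 : Fin 3) (parD 0 f) = parD 0 (parD 2 f) := parD_comm _ _ _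
  have h21 : parD (2 : Fin 3) (parD 1 f) = parD 1 (parD 2 f) := parD_comm _ _ _
  have e1 : (1 : Fin 3) + 1 = 2 := rfl
  have e2 : (1 : Fin 3) + 2 = 0 := rfl
  have e3 : (2 : Fin 3) + 1 = 0 := rfl
  have e4 : (2 : Fin 3) + 2 = 1 := rfl
  have hI : -Complex.I * (ħ : ℂ) * (-Complex.I * (ħ : ℂ)) = -(ħ : ℂ) ^ 2 := by
    linear_combination (ħ : ℂ) ^ 2 * Complex.I_mul_I
  simp only [orbitalOp, LinearMap.smul_apply, LinearMap.sub_apply, LinearMap.comp_apply,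
    map_smul, smul_smul, hI, neg_smul]
  rw [Finset.sum_neg_distrib, ← Finset.smul_sum, ← smul_neg, ← Finset.sum_neg_distrib]
  congr 1
  -- Normal ordering: all coordinates move to the left of all derivatives and mixed partials take a
  -- fixed order, so that both sides become combinations of the same vectors.
  simp only [eulerOp, laplaceOp, normSqOp,
    LinearMap.comp_apply, LinearMap.add_apply, Fin.sum_univ_three, map_add, map_sub, parD_mulX, zero_add, e1, e2, e3, e4,
    h10, h20, h21, Fin.reduceEq, if_true, if_false, map_smul]
  refine Subtype.ext <| funext fun x => ?_
  simp only [Submodule.coe_add, Submodule.coe_sub, Submodule.coe_neg, Submodule.coe_smul,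
    Pi.add_apply, Pi.sub_apply, Pi.neg_apply, Pi.smul_apply, mulX_apply]
  module

/-! ### Commutation of the angular momentum with `σ · x` -/

theorem sum_fin_three_rotate {M : Type*} [AddCommMonoid M] (g : Fin 3 → M) (j : Fin 3) :
    ∑ k, g k = g j + g (j + 1) + g (j + 2) := by
  fin_cases j <;> simp [Fin.sum_univ_three] <;> abel

theorem orbitalOp_spinOp (ħ : ℝ) (A : Spin n →L[ℂ] Spin n) (j : Fin 3) (f : SmoothFun n) :
    orbitalOp ħ j (spinOp A f) = spinOp A (orbitalOp ħ j f) := by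
  simp only [orbitalOp, LinearMap.smul_apply, LinearMap.sub_apply, LinearMap.comp_apply,
    map_smul, map_sub, parD_spinOp, mulX_spinOp]

theorem orbitalOp_mulX (ħ : ℝ) (j k : Fin 3) (f : SmoothFun n) :
    orbitalOp ħ j (mulX k f) = mulX k (orbitalOp ħ j f) +
      (-Complex.I * (ħ : ℂ)) • ((if j + 2 = k then (1 : ℂ) else 0) • mulX (j + 1) f -
        (if j + 1 = k then (1 : ℂ) else 0) • mulX (j + 2) f) := by
  simp only [orbitalOp, LinearMap.smul_apply, LinearMap.sub_apply, LinearMap.comp_apply,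
    map_smul, map_sub, map_add, parD_mulX]
  refine Subtype.ext <| funext fun x => ?_
  simp only [Submodule.coe_add, Submodule.coe_sub, Submodule.coe_smul,
    Pi.add_apply, Pi.sub_apply, Pi.smul_apply, mulX_apply]
  module

/-- `σ · x` is a scalar under simultaneous rotation of space and spin: `[L_j, x_k]` and `[σ_j, σ_k]`
have the same structure constants, and their contributions cancel by antisymmetry. Summing
cyclically from `j` treats the three axes at once. -/
theorem angularOp_sigmaX (ħ : ℝ) (j : Fin 3) (f : SmoothFun n) :
    angularOp ħ j (sigmaX ħ f) = sigmaX ħ (angularOp ħ j f) := by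
  have c1 := DFunLike.congr_fun (sigma_commutator ħ n j)
  have c2 := DFunLike.congr_fun (sigma_commutator ħ n (j + 2))
  have e1 : j + 2 + 1 = j := by fin_cases j <;> rfl
  have e2 : j + 2 + 2 = j + 1 := by fin_cases j <;> rfl
  have n1 : j + 2 ≠ j := by fin_cases j <;> decide
  have n2 : j + 1 ≠ j := by fin_cases j <;> decide
  have n3 : j + 2 ≠ j + 1 := by fin_cases j <;> decide
  rw [e1, e2] at c2
  simp only [sub_apply, smul_apply, mul_apply_eq_comp, sub_eq_iff_eq_add] at c1 c2
  simp only [sigmaX, angularOp, LinearMap.comp_apply,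
    LinearMap.add_apply, map_add, sum_fin_three_rotate _ j, orbitalOp_mulX, orbitalOp_spinOp, n1, n2,
    n3, n3.symm, if_true, if_false]
  refine Subtype.ext <| funext fun x => ?_
  simp only [Submodule.coe_add, Submodule.coe_sub, Submodule.coe_smul,
    Pi.add_apply, Pi.sub_apply, Pi.smul_apply, mulX_apply, spinOp_apply, map_smul, c1, c2]
  module

theorem angularSqOp_sigmaX (ħ : ℝ) (f : SmoothFun n) :
    angularSqOp ħ (sigmaX ħ f) = sigmaX ħ (angularSqOp ħ f) := by
  simp only [angularSqOp, LinearMap.coe_sum, Finset.sum_apply, LinearMap.comp_apply,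
    angularOp_sigmaX, map_sum]

theorem sigmaX_apply (ħ : ℝ) (f : SmoothFun n) (x : E3) :
    (sigmaX ħ f).1 x = sigmaDot ħ n (toComplex x) (f.1 x) := by
  simp [sigmaX, sigmaDot, toComplex, Fin.sum_univ_three]

/-! ### Polynomials -/

/-- The polynomial functions of degree less than `d`. -/
def polyFun (n : ℕ) : ℕ → Submodule ℂ (SmoothFun n)
  | 0 => ⊥
  | d + 1 => LinearMap.range constFun ⊔ ⨆ k, (polyFun n d).map (mulX k)

instance finiteDimensional_polyFun (d : ℕ) : FiniteDimensional ℂ (polyFun n d) := by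
  induction d with
  | zero => rw [polyFun]; infer_instance
  | succ d ih => rw [polyFun]; infer_instance

theorem constFun_mem (v : Spin n) (d : ℕ) : constFun v ∈ polyFun n (d + 1) := by
  rw [polyFun]; exact Submodule.mem_sup_left ⟨v, rfl⟩

theorem mulX_mem {d : ℕ} {f : SmoothFun n} (hf : f ∈ polyFun n d) (k : Fin 3) :
    mulX k f ∈ polyFun n (d + 1) := by
  rw [polyFun]
  exact Submodule.mem_sup_right (Submodule.mem_iSup_of_mem k (Submodule.mem_map_of_mem hf))

theorem exists_of_mem_polyFun_succ {d : ℕ} {f : SmoothFun n} (hf : f ∈ polyFun n (d + 1)) :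
    ∃ (v : Spin n) (g : Fin 3 → SmoothFun n), (∀ k, g k ∈ polyFun n d) ∧
      f = constFun v + ∑ k, mulX k (g k) := by
  rw [polyFun, Submodule.mem_sup] at hf
  obtain ⟨y, ⟨v, rfl⟩, z, hz, rfl⟩ := hf
  rw [Submodule.mem_iSup_iff_exists_finsupp] at hz
  obtain ⟨w, hw, rfl⟩ := hz
  choose g hg hgw using hw
  refine ⟨v, g, hg, ?_⟩
  rw [Finsupp.sum_fintype _ _ (by simp)]
  simp only [hgw]

theorem polyFun_le_succ (d : ℕ) : polyFun n d ≤ polyFun n (d + 1) := by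
  induction d with
  | zero => exact bot_le
  | succ d ih =>
    intro f hf
    obtain ⟨v, g, hg, rfl⟩ := exists_of_mem_polyFun_succ hf
    exact add_mem (constFun_mem v _) (Submodule.sum_mem _ fun k _ => mulX_mem (ih (hg k)) k)

theorem polyFun_mono : Monotone (polyFun n) := monotone_nat_of_le_succ polyFun_le_succ

theorem parD_mem {d : ℕ} {f : SmoothFun n} (hf : f ∈ polyFun n (d + 1)) (k : Fin 3) :
    parD k f ∈ polyFun n d := by
  induction d generalizing f with
  | zero =>
    obtain ⟨v, g, hg, rfl⟩ := exists_of_mem_polyFun_succ hf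
    have : ∀ k, g k = 0 := fun k => (Submodule.mem_bot ℂ).1 (hg k)
    simp [this, parD_constFun]
  | succ d ih =>
    obtain ⟨v, g, hg, rfl⟩ := exists_of_mem_polyFun_succ hf
    simp only [map_add, map_sum, parD_constFun, zero_add, parD_mulX]
    refine Submodule.sum_mem _ fun i _ => add_mem (Submodule.smul_mem _ _ (hg i)) ?_
    exact mulX_mem (ih (hg i)) i

theorem mulX_parD_mem {d : ℕ} {f : SmoothFun n} (hf : f ∈ polyFun n d) (i k : Fin 3) :
    mulX i (parD k f) ∈ polyFun n d := by
  cases d with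
  | zero => simp [(Submodule.mem_bot ℂ).1 hf]
  | succ d => exact mulX_mem (parD_mem hf k) i

theorem spinOp_mem {d : ℕ} {f : SmoothFun n} (hf : f ∈ polyFun n d)
    (A : Spin n →L[ℂ] Spin n) : spinOp A f ∈ polyFun n d := by
  induction d generalizing f with
  | zero => simp [(Submodule.mem_bot ℂ).1 hf]
  | succ d ih =>
    obtain ⟨v, g, hg, rfl⟩ := exists_of_mem_polyFun_succ hf
    rw [map_add, map_sum]
    refine add_mem (constFun_mem (A v) d) (Submodule.sum_mem _ fun k _ => ?_)
    rw [← mulX_spinOp]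
    exact mulX_mem (ih (hg k)) k

theorem angularOp_mem {d : ℕ} {f : SmoothFun n} (hf : f ∈ polyFun n d) (ħ : ℝ) (j : Fin 3) :
    angularOp ħ j f ∈ polyFun n d :=
  add_mem (Submodule.smul_mem _ _ (sub_mem (mulX_parD_mem hf _ _) (mulX_parD_mem hf _ _)))
    (spinOp_mem hf _)

theorem angularSqOp_mem {d : ℕ} {f : SmoothFun n} (hf : f ∈ polyFun n d) (ħ : ℝ) :
    angularSqOp ħ f ∈ polyFun n d := by
  simp only [angularSqOp, LinearMap.coe_sum, Finset.sum_apply, LinearMap.comp_apply]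
  exact Submodule.sum_mem _ fun j _ => angularOp_mem (angularOp_mem hf ħ j) ħ j

theorem eulerOp_mem {d : ℕ} {f : SmoothFun n} (hf : f ∈ polyFun n d) :
    eulerOp f ∈ polyFun n d := by
  simp only [eulerOp, LinearMap.coe_sum, Finset.sum_apply, LinearMap.comp_apply]
  exact Submodule.sum_mem _ fun j _ => mulX_parD_mem hf _ _

theorem eulerOp_mulX (k : Fin 3) (f : SmoothFun n) :
    eulerOp (mulX k f) = mulX k (eulerOp f) + mulX k f := by
  have hc : ∀ i (g : SmoothFun n), mulX i (mulX k g) = mulX k (mulX i g) := fun i g =>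
    Subtype.ext (funext fun x => smul_comm ((x i : ℝ) : ℂ) ((x k : ℝ) : ℂ) (g.1 x))
  simp only [eulerOp, LinearMap.coe_sum, Finset.sum_apply, LinearMap.comp_apply, parD_mulX,
    map_add, hc, Finset.sum_add_distrib, map_sum, map_smul]
  simp [add_comm]

/-- Multiplication by a coordinate raises the Euler degree by one, so `(E - (d + 1)) x_k g = x_k (E
- d) g`, and the induction closes; only the constant term is left over. -/
theorem eulerOp_sub_mem {d : ℕ} {f : SmoothFun n} (hf : f ∈ polyFun n (d + 1)) :
    eulerOp f - (d : ℂ) • f ∈ polyFun n d := by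
  induction d generalizing f with
  | zero =>
    simp only [eulerOp, LinearMap.coe_sum, Finset.sum_apply, LinearMap.comp_apply]
    have h : ∀ k, parD k f = 0 := fun k => (Submodule.mem_bot ℂ).1 (parD_mem hf k)
    simp [h]
  | succ d ih =>
    obtain ⟨v, g, hg, rfl⟩ := exists_of_mem_polyFun_succ hf
    have h0 : eulerOp (constFun v) = 0 := by simp [eulerOp, parD_constFun]
    have h1 : eulerOp (constFun v + ∑ k, mulX k (g k)) -
        ((d + 1 : ℕ) : ℂ) • (constFun v + ∑ k, mulX k (g k)) =
        -((d + 1 : ℕ) : ℂ) • constFun v + ∑ k, mulX k (eulerOp (g k) - (d : ℂ) • g k) := by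
      simp only [map_add, map_sum, h0, eulerOp_mulX, map_sub, map_smul, Finset.sum_add_distrib,
        Finset.sum_sub_distrib, ← Finset.smul_sum]
      push_cast
      module
    rw [h1]
    exact add_mem (Submodule.smul_mem _ _ (constFun_mem v d))
      (Submodule.sum_mem _ fun k _ => mulX_mem (ih (hg k)) k)

/-- On polynomials of degree at most `d` on a sphere, `∑ L_j²` is `ħ² d (d + 1)` up to lower
degree. -/
theorem orbitalOp_sq_poly {d : ℕ} {f : SmoothFun n} (hf : f ∈ polyFun n (d + 1)) (ħ : ℝ) :
    ∃ g ∈ polyFun n d, ∃ h ∈ polyFun n d, ∑ j, orbitalOp ħ j (orbitalOp ħ j f) =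
      ((ħ ^ 2 * (d * (d + 1)) : ℝ) : ℂ) • f + (g + normSqOp h) := by
  have hE := eulerOp_sub_mem hf
  -- The factorization `E² + E - d (d + 1) = E (E - d) + (d + 1)(E - d)` shows that this part has
  -- lower degree; the second witness comes from the term `|x|² Δ`, and `|x|²` is constant on the
  -- sphere.
  refine ⟨((ħ : ℂ) ^ 2) • (eulerOp (eulerOp f - (d : ℂ) • f) +
    ((d : ℂ) + 1) • (eulerOp f - (d : ℂ) • f)), Submodule.smul_mem _ _
      (add_mem (eulerOp_mem hE) (Submodule.smul_mem _ _ hE)), -((ħ : ℂ) ^ 2) • laplaceOp f,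
      Submodule.smul_mem _ _ ?_, ?_⟩
  · simp only [laplaceOp, LinearMap.coe_sum, Finset.sum_apply, LinearMap.comp_apply]
    exact Submodule.sum_mem _ fun k _ => parD_mem (polyFun_le_succ _ (parD_mem hf k)) k
  · rw [orbitalOp_sq]
    simp only [map_sub, map_smul]
    push_cast
    module

end SmoothFunctions

end MonopoleSphere

namespace MonopoleSphere

/-! ### The surface measure -/

section SurfaceMeasure

open scoped Pointwise

variable {n : ℕ} {r : ℝ}

instance isFiniteMeasure_surfaceMeasure (r : ℝ) : IsFiniteMeasure (surfaceMeasure r) := by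
  have h : IsFiniteMeasure ((Measure.map (fun u : Metric.sphere (0 : E3) 1 => r • (u : E3))
      (volume : Measure E3).toSphere).comap (Subtype.val : RealSphere r → E3)) := by
    refine ⟨?_⟩
    rw [(MeasurableEmbedding.subtype_coe Metric.isClosed_sphere.measurableSet).comap_apply]
    exact measure_lt_top _ _
  exact Measure.smul_finite _ ENNReal.ofReal_ne_top

/-- The dilation of the unit sphere onto the sphere of radius `r`. -/
def dilate (hr : 0 < r) (u : Metric.sphere (0 : E3) 1) : RealSphere r :=
  ⟨r • (u : E3), by
    rw [mem_sphere_zero_iff_norm, norm_smul, mem_sphere_zero_iff_norm.1 u.2, mul_one,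
      Real.norm_of_nonneg hr.le]⟩

theorem continuous_dilate (hr : 0 < r) : Continuous (dilate hr) :=
  Continuous.subtype_mk (by fun_prop) _

theorem surjective_dilate (hr : 0 < r) : Function.Surjective (dilate hr) := fun x => by
  have hx := mem_sphere_zero_iff_norm.1 x.2
  refine ⟨⟨r⁻¹ • (x : E3), ?_⟩, Subtype.ext (smul_inv_smul₀ hr.ne' _)⟩
  rw [mem_sphere_zero_iff_norm, norm_smul, hx, norm_inv, Real.norm_of_nonneg hr.le,
    inv_mul_cancel₀ hr.ne']

theorem surfaceMeasure_eq (hr : 0 < r) : surfaceMeasure r =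
    ENNReal.ofReal (r ^ 2) • Measure.map (dilate hr) (volume : Measure E3).toSphere := by
  rw [surfaceMeasure]
  congr 1
  have h : (fun u : Metric.sphere (0 : E3) 1 => r • (u : E3)) = Subtype.val ∘ dilate hr := rfl
  rw [h, ← Measure.map_map measurable_subtype_coe (continuous_dilate hr).measurable,
    (MeasurableEmbedding.subtype_coe Metric.isClosed_sphere.measurableSet).comap_map]

theorem isOpenPosMeasure_surfaceMeasure (hr : 0 < r) : (surfaceMeasure r).IsOpenPosMeasure := by
  rw [surfaceMeasure_eq hr]
  have h := (continuous_dilate hr).isOpenPosMeasure_map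
    (μ := (volume : Measure E3).toSphere) (surjective_dilate hr)
  refine ⟨fun U hU hne h0 => h.open_pos U hU hne ?_⟩
  rw [Measure.smul_apply, smul_eq_mul, mul_eq_zero] at h0
  exact h0.resolve_left (by simpa using hr.ne')

/-- The measure of a spherical cap of radius `ε` is at least of the order `ε³`. -/
theorem exists_le_surfaceMeasure_ball (hr : 0 < r) : ∃ c : ℝ, 0 < c ∧ ∀ x : RealSphere r,
    ∀ ε : ℝ, 0 < ε → ε ≤ r → c * ε ^ 3 ≤ (surfaceMeasure r).real (Metric.ball x ε) := by
  have hv : 0 < (volume : Measure E3).real (Metric.ball 0 1) :=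
    ENNReal.toReal_pos (Metric.measure_ball_pos _ _ one_pos).ne' measure_ball_lt_top.ne
  refine ⟨r ^ 2 * (3 * (1 / (4 * r)) ^ 3 * (volume : Measure E3).real (Metric.ball 0 1)),
    by positivity, fun x ε hε hεr => ?_⟩
  obtain ⟨u, rfl⟩ := surjective_dilate hr x
  have h := (volume : Measure E3).toSphereBallBound_mul_measureReal_unitBall_le_toSphere_ball
    (div_pos hε hr) u
  have h2 : (surfaceMeasure r).real (Metric.ball (dilate hr u) ε) =
      r ^ 2 * (volume : Measure E3).toSphere.real (Metric.ball u (ε / r)) := by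
    rw [surfaceMeasure_eq hr, measureReal_ennreal_smul_apply, ENNReal.toReal_ofReal (by positivity),
      map_measureReal_apply (continuous_dilate hr).measurable Metric.isOpen_ball.measurableSet]
    congr 2
    ext v
    rw [Set.mem_preimage, Metric.mem_ball, Metric.mem_ball, Subtype.dist_eq, Subtype.dist_eq]
    change dist (r • (v : E3)) (r • (u : E3)) < ε ↔ _
    rw [dist_smul₀, Real.norm_of_nonneg hr.le, lt_div_iff₀ hr, mul_comm]
  rw [h2]
  -- Since `ε ≤ r`, the truncation at `2` in the bound is inactive. The exponent is the dimension of
  -- the ambient space; being weaker than the true order `ε²` only affects geometric constants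
  -- later.
  have h3 : (Measure.toSphereBallBound (Module.finrank ℝ E3) (ε / r) : ℝ) =
      3 * (1 / (4 * r)) ^ 3 * ε ^ 3 := by
    have h4 : Module.finrank ℝ E3 = 3 := finrank_euclideanSpace_fin
    have h5 : min (ε / r).toNNReal 2 = (ε / r).toNNReal := by
      refine min_eq_left (Real.toNNReal_le_iff_le_coe.2 ?_)
      rw [div_le_iff₀ hr]
      push_cast
      linarith
    rw [h4, Measure.toSphereBallBound, if_pos ⟨by norm_num, div_pos hε hr⟩, h5]
    push_cast
    rw [Real.coe_toNNReal _ (div_pos hε hr).le]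
    field_simp
  rw [h3] at h
  nlinarith [mul_le_mul_of_nonneg_left h (sq_nonneg r)]

/-- The action of a linear isometry on a sphere. -/
def sphereMap (R : E3 ≃ₗᵢ[ℝ] E3) (x : RealSphere r) : RealSphere r :=
  ⟨R x, by rw [mem_sphere_zero_iff_norm, R.norm_map, mem_sphere_zero_iff_norm.1 x.2]⟩

theorem continuous_sphereMap (R : E3 ≃ₗᵢ[ℝ] E3) : Continuous (sphereMap (r := r) R) :=
  Continuous.subtype_mk (R.continuous.comp continuous_subtype_val) _

/-- The measure of a set is a multiple of the volume of the cone over it, and a linear isometry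
commutes with forming cones and preserves volume. -/
theorem map_sphereMap_toSphere (R : E3 ≃ₗᵢ[ℝ] E3) :
    Measure.map (sphereMap R) (volume : Measure E3).toSphere =
      (volume : Measure E3).toSphere := by
  ext s hs
  have hm := (continuous_sphereMap (r := 1) R).measurable
  rw [Measure.map_apply hm hs, Measure.toSphere_apply' _ (hm hs), Measure.toSphere_apply' _ hs]
  congr 1
  have h : Set.Ioo (0 : ℝ) 1 • ((↑) '' (sphereMap (r := 1) R ⁻¹' s) : Set E3) =
      R ⁻¹' (Set.Ioo (0 : ℝ) 1 • ((↑) '' s)) := by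
    ext y
    simp only [Set.mem_smul, Set.mem_preimage, Set.mem_image]
    constructor
    · rintro ⟨t, ht, _, ⟨x, hx, rfl⟩, rfl⟩
      exact ⟨t, ht, _, ⟨_, hx, rfl⟩, (map_smul R t (x : E3)).symm⟩
    · rintro ⟨t, ht, _, ⟨x, hx, rfl⟩, hy⟩
      have hx' : sphereMap R (sphereMap R.symm x) = x := Subtype.ext (R.apply_symm_apply _)
      refine ⟨t, ht, _, ⟨sphereMap R.symm x, by rwa [hx'], rfl⟩, ?_⟩
      apply R.injective
      rw [map_smul, ← hy]
      exact congrArg _ (R.apply_symm_apply _)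
  rw [h]
  exact (R.measurePreserving).measure_preimage_equiv (f := R.toHomeomorph.toMeasurableEquiv) _

theorem map_sphereMap (hr : 0 < r) (R : E3 ≃ₗᵢ[ℝ] E3) :
    Measure.map (sphereMap R) (surfaceMeasure r) = surfaceMeasure r := by
  rw [surfaceMeasure_eq hr, Measure.map_smul,
    Measure.map_map (continuous_sphereMap R).measurable (continuous_dilate hr).measurable]
  have h : sphereMap R ∘ dilate hr = dilate hr ∘ sphereMap R := by
    funext u
    exact Subtype.ext (map_smul R r (u : E3))
  rw [h, ← Measure.map_map (continuous_dilate hr).measurable (continuous_sphereMap R).measurable,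
    map_sphereMap_toSphere]

/-- The rotation by the angle `t` about the axis `j`. -/
def rotation (j : Fin 3) (t : ℝ) : E3 →ₗ[ℝ] E3 where
  toFun x := x + ((Real.cos t - 1) * x (j + 1) - Real.sin t * x (j + 2)) •
      EuclideanSpace.single (j + 1) (1 : ℝ) +
    (Real.sin t * x (j + 1) + (Real.cos t - 1) * x (j + 2)) •
      EuclideanSpace.single (j + 2) (1 : ℝ)
  map_add' x y := by simp only [PiLp.add_apply]; module
  map_smul' c x := by simp only [PiLp.smul_apply, smul_eq_mul, RingHom.id_apply]; module

theorem norm_rotation (j : Fin 3) (t : ℝ) (x : E3) : ‖rotation j t x‖ = ‖x‖ := by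
  have n1 : j + 2 ≠ j := by fin_cases j <;> decide
  have n2 : j + 1 ≠ j := by fin_cases j <;> decide
  have n3 : j + 2 ≠ j + 1 := by fin_cases j <;> decide
  rw [EuclideanSpace.norm_eq, EuclideanSpace.norm_eq]
  congr 1
  simp only [sum_fin_three_rotate _ j, Real.norm_eq_abs, sq_abs]
  simp [rotation, n1.symm, n2.symm, n3, n3.symm]
  linear_combination (x (j + 1) ^ 2 + x (j + 2) ^ 2) * Real.sin_sq_add_cos_sq t

/-- The rotation by the angle `t` about the axis `j`, as a linear isometry. -/
def rotationIsometry (j : Fin 3) (t : ℝ) : E3 ≃ₗᵢ[ℝ] E3 :=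
  LinearIsometry.toLinearIsometryEquiv ⟨rotation j t, norm_rotation j t⟩ rfl

/-- The rotations are the flow of the vector field which, up to the factor `-i ħ`, is `L_j`. -/
theorem hasDerivAt_rotation (j : Fin 3) (t : ℝ) (x : E3) :
    HasDerivAt (fun t => rotation j t x)
      ((rotation j t x) (j + 1) • EuclideanSpace.single (j + 2) (1 : ℝ) -
        (rotation j t x) (j + 2) • EuclideanSpace.single (j + 1) (1 : ℝ)) t := by
  have n3 : j + 2 ≠ j + 1 := by fin_cases j <;> decide
  have hc := Real.hasDerivAt_cos t
  have hs := Real.hasDerivAt_sin t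
  have h := (((((hc.sub_const 1).mul_const (x (j + 1))).sub (hs.mul_const (x (j + 2)))).smul_const
    (EuclideanSpace.single (j + 1) (1 : ℝ))).const_add x).add
    (((hs.mul_const (x (j + 1))).add ((hc.sub_const 1).mul_const (x (j + 2)))).smul_const
      (EuclideanSpace.single (j + 2) (1 : ℝ)))
  refine h.congr_deriv ?_
  simp [rotation, n3, n3.symm]
  module

theorem rotation_zero (j : Fin 3) (x : E3) : rotation j 0 x = x := by simp [rotation]

/-- Integration by parts on the sphere. -/
theorem integral_rotation_derivative (hr : 0 < r) (j : Fin 3) {h : E3 → ℂ}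
    (hh : ContDiff ℝ ∞ h) :
    ∫ x : RealSphere r, (((x : E3) (j + 1)) • fderiv ℝ h x (EuclideanSpace.single (j + 2) (1 : ℝ)) -
      ((x : E3) (j + 2)) • fderiv ℝ h x (EuclideanSpace.single (j + 1) (1 : ℝ)))
      ∂surfaceMeasure r = 0 := by
  set D : E3 → ℂ := fun x => (x (j + 1)) • fderiv ℝ h x (EuclideanSpace.single (j + 2) (1 : ℝ)) -
      (x (j + 2)) • fderiv ℝ h x (EuclideanSpace.single (j + 1) (1 : ℝ)) with hD
  have hd : Continuous (fderiv ℝ h) := hh.continuous_fderiv (by simp)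
  have hDc : Continuous D := by
    have : ∀ i : Fin 3, Continuous fun x : E3 => x i := fun i => by fun_prop
    exact ((this _).smul (hd.clm_apply continuous_const)).sub
      ((this _).smul (hd.clm_apply continuous_const))
  have hderiv : ∀ (x : E3) (t : ℝ), HasDerivAt (fun t => h (rotation j t x))
      (D (rotation j t x)) t := fun x t => by
    have := ((hh.differentiable (by simp)) (rotation j t x)).hasFDerivAt.comp_hasDerivAt t
      (hasDerivAt_rotation j t x)
    rw [map_sub, map_smul, map_smul] at this
    exact this
  obtain ⟨C, hC⟩ := (isCompact_sphere (0 : E3) r).exists_bound_of_continuousOn hDc.continuousOn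
  have hmaps : ∀ (t : ℝ) (x : RealSphere r), rotation j t x ∈ Metric.sphere (0 : E3) r :=
    fun t x => by rw [mem_sphere_zero_iff_norm, norm_rotation, mem_sphere_zero_iff_norm.1 x.2]
  have hcont : ∀ t, Continuous fun x : RealSphere r => rotation j t x := fun t =>
    (rotationIsometry j t).continuous.comp continuous_subtype_val
  have hint : ∀ f : E3 → ℂ, Continuous f → ∀ t, Integrable
      (fun x : RealSphere r => f (rotation j t x)) (surfaceMeasure r) := fun f hf t =>
    (hf.comp (hcont t)).integrable_of_hasCompactSupport (HasCompactSupport.of_compactSpace _)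
  -- Differentiation under the integral of `h ∘ R_t` at `t = 0`, dominated by the maximum of `D` on
  -- the compact sphere. Rotation invariance of the measure makes this integral constant, so its
  -- derivative vanishes.
  have key := (hasDerivAt_integral_of_dominated_loc_of_deriv_le (μ := surfaceMeasure r)
    (F := fun t (x : RealSphere r) => h (rotation j t x))
    (F' := fun t (x : RealSphere r) => D (rotation j t x)) (bound := fun _ => C) (x₀ := (0 : ℝ))
    (s := Set.univ) univ_mem
    (Eventually.of_forall fun t => (hint h hh.continuous t).aestronglyMeasurable)
    (hint h hh.continuous 0) (hint D hDc 0).aestronglyMeasurable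
    (Eventually.of_forall fun x t _ => hC _ (hmaps t x)) (integrable_const C)
    (Eventually.of_forall fun x t _ => hderiv x t)).2
  have hconst : ∀ t, ∫ x : RealSphere r, h (rotation j t x) ∂surfaceMeasure r =
      ∫ x : RealSphere r, h x ∂surfaceMeasure r := fun t => by
    conv_rhs => rw [← map_sphereMap hr (rotationIsometry j t)]
    exact (integral_map (μ := surfaceMeasure r) (φ := sphereMap (rotationIsometry j t))
      (f := fun x : RealSphere r => h x) (continuous_sphereMap _).measurable.aemeasurable
      (hh.continuous.comp continuous_subtype_val).aestronglyMeasurable).symm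
  simp only [hconst, rotation_zero] at key
  exact key.unique (hasDerivAt_const _ _)

/-- The class in `L²` of the restriction of a smooth function to the sphere. -/
def restrict (r : ℝ) : SmoothFun n →ₗ[ℂ] L2 r n where
  toFun f := ContinuousMap.toLp 2 (surfaceMeasure r) ℂ
    ⟨fun x => f.1 x, (SmoothFun.contDiff f).continuous.comp continuous_subtype_val⟩
  map_add' f g := (ContinuousMap.toLp (E := Spin n) 2 (surfaceMeasure r) ℂ).map_add
    ⟨fun x => f.1 x, (SmoothFun.contDiff f).continuous.comp continuous_subtype_val⟩
    ⟨fun x => g.1 x, (SmoothFun.contDiff g).continuous.comp continuous_subtype_val⟩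
  map_smul' c f := (ContinuousMap.toLp (E := Spin n) 2 (surfaceMeasure r) ℂ).map_smul c
    ⟨fun x => f.1 x, (SmoothFun.contDiff f).continuous.comp continuous_subtype_val⟩

theorem coeFn_restrict (f : SmoothFun n) :
    ∀ᵐ x ∂surfaceMeasure r, restrict r f x = f.1 x :=
  ContinuousMap.coeFn_toLp (p := 2) (𝕜 := ℂ) (surfaceMeasure r) _

theorem restrict_congr {f g : SmoothFun n} (h : ∀ x : RealSphere r, f.1 x = g.1 x) :
    restrict r f = restrict r g := by
  change ContinuousMap.toLp 2 (surfaceMeasure r) ℂ _ = ContinuousMap.toLp 2 (surfaceMeasure r) ℂ _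
  congr 2
  exact funext h

theorem inner_restrict (f g : SmoothFun n) :
    ⟪restrict r f, restrict r g⟫_ℂ = ∫ x : RealSphere r, ⟪f.1 x, g.1 x⟫_ℂ ∂surfaceMeasure r := by
  rw [MeasureTheory.L2.inner_def]
  refine integral_congr_ae ?_
  filter_upwards [coeFn_restrict (r := r) f, coeFn_restrict (r := r) g] with x hf hg
  rw [hf, hg]

theorem integrable_inner_smooth (f g : SmoothFun n) :
    Integrable (fun x : RealSphere r => ⟪f.1 x, g.1 x⟫_ℂ) (surfaceMeasure r) :=
  (((SmoothFun.contDiff f).continuous.comp continuous_subtype_val).inner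
    ((SmoothFun.contDiff g).continuous.comp continuous_subtype_val)).integrable_of_hasCompactSupport
    (HasCompactSupport.of_compactSpace _)

theorem inner_restrict_spinOp (ħ : ℝ) (j : Fin 3) (f g : SmoothFun n) :
    ⟪restrict r (spinOp (sigma ħ n j) f), restrict r g⟫_ℂ =
      ⟪restrict r f, restrict r (spinOp (sigma ħ n j) g)⟫_ℂ := by
  simp only [inner_restrict, spinOp_apply, inner_sigma]

theorem inner_restrict_orbitalOp (hr : 0 < r) (ħ : ℝ) (j : Fin 3) (f g : SmoothFun n) :
    ⟪restrict r (orbitalOp ħ j f), restrict r g⟫_ℂ =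
      ⟪restrict r f, restrict r (orbitalOp ħ j g)⟫_ℂ := by
  have hh : ContDiff ℝ ∞ fun x => ⟪f.1 x, g.1 x⟫_ℂ :=
    (SmoothFun.contDiff f).inner ℂ (SmoothFun.contDiff g)
  have h0 := integral_rotation_derivative hr j hh
  have hfd : ∀ x v, fderiv ℝ (fun x => ⟪f.1 x, g.1 x⟫_ℂ) x v =
      ⟪f.1 x, fderiv ℝ g.1 x v⟫_ℂ + ⟪fderiv ℝ f.1 x v, g.1 x⟫_ℂ := fun x v =>
    fderiv_inner_apply ℂ (SmoothFun.differentiable f x) (SmoothFun.differentiable g x) v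
  rw [inner_restrict, inner_restrict, ← sub_eq_zero,
    ← integral_sub (integrable_inner_smooth _ _) (integrable_inner_smooth _ _)]
  -- As `-i ħ` is imaginary, the difference of the two integrands is `i ħ` times the rotational
  -- derivative of `⟪f, g⟫`.
  rw [← mul_zero (Complex.I * (ħ : ℂ)), ← h0, ← integral_const_mul]
  refine integral_congr_ae (Eventually.of_forall fun x => ?_)
  have hv : ∀ (f : SmoothFun n) (x : E3), (orbitalOp ħ j f).1 x = orbital ħ j f.1 x :=
    fun _ _ => rfl
  simp only [hv, orbital, partialDeriv, hfd, inner_smul_left, inner_smul_right, inner_sub_left,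
    inner_sub_right, map_mul, map_neg, Complex.conj_I, Complex.conj_ofReal, Complex.real_smul]
  ring

theorem inner_restrict_angularOp (hr : 0 < r) (ħ : ℝ) (j : Fin 3) (f g : SmoothFun n) :
    ⟪restrict r (angularOp ħ j f), restrict r g⟫_ℂ =
      ⟪restrict r f, restrict r (angularOp ħ j g)⟫_ℂ := by
  simp only [angularOp, LinearMap.add_apply, map_add, inner_add_left, inner_add_right,
    inner_restrict_orbitalOp hr, inner_restrict_spinOp]

theorem inner_restrict_angularSqOp (hr : 0 < r) (ħ : ℝ) (f g : SmoothFun n) :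
    ⟪restrict r (angularSqOp ħ f), restrict r g⟫_ℂ =
      ⟪restrict r f, restrict r (angularSqOp ħ g)⟫_ℂ := by
  simp only [angularSqOp, LinearMap.coe_sum, Finset.sum_apply, LinearMap.comp_apply, map_sum,
    sum_inner, inner_sum, inner_restrict_angularOp hr]

end SurfaceMeasure

end MonopoleSphere

/-! ### The heat equation of a diagonal operator -/

section DiagonalHeat

variable {ι H : Type*} [NormedAddCommGroup H] [InnerProductSpace ℂ H]

theorem HilbertBasis.hasSum_norm_sq (b : HilbertBasis ι ℂ H) (x : H) :
    HasSum (fun i => ‖⟪b i, x⟫_ℂ‖ ^ 2) (‖x‖ ^ 2) := by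
  have h := Complex.hasSum_re (b.hasSum_inner_mul_inner x x)
  rw [inner_self_eq_norm_sq_to_K] at h
  convert h using 1
  · funext i
    rw [← inner_conj_symm x (b i), mul_comm, Complex.mul_conj, Complex.ofReal_re,
      Complex.normSq_eq_norm_sq]
  · norm_cast

theorem HilbertBasis.ext_inner (b : HilbertBasis ι ℂ H) {x y : H}
    (h : ∀ i, ⟪b i, x⟫_ℂ = ⟪b i, y⟫_ℂ) : x = y := by
  have h1 := b.hasSum_norm_sq (x - y)
  simp only [inner_sub_right, h, sub_self, norm_zero, ne_eq, OfNat.ofNat_ne_zero,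
    not_false_eq_true, zero_pow] at h1
  have h2 := h1.unique hasSum_zero
  rwa [sq_eq_zero_iff, norm_eq_zero, sub_eq_zero] at h2

theorem HilbertBasis.exists_multiplier (b : HilbertBasis ι ℂ H) {m : ι → ℂ} {C : ℝ}
    (hm : ∀ i, ‖m i‖ ≤ C) (ψ : H) : ∃ x, ∀ i, ⟪b i, x⟫_ℂ = m i * ⟪b i, ψ⟫_ℂ := by
  have hmem : Memℓp (fun i => m i * ⟪b i, ψ⟫_ℂ) 2 := by
    refine memℓp_gen ?_
    simp only [ENNReal.toReal_ofNat, Real.rpow_ofNat]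
    refine Summable.of_nonneg_of_le (fun _ => by positivity) (fun i => ?_)
      ((b.hasSum_norm_sq ψ).summable.mul_left (C ^ 2))
    rw [norm_mul, mul_pow]
    gcongr
    exact hm i
  refine ⟨b.repr.symm ⟨_, hmem⟩, fun i => ?_⟩
  rw [← b.repr_apply_apply, LinearIsometryEquiv.apply_symm_apply]

/-- Parseval turns `‖X a - x‖²` into a series dominated by `C² |⟪b i, ψ⟫|²`, so dominated
convergence applies. It serves both the continuity and the differentiability of the heat flow. -/
theorem HilbertBasis.tendsto_of_coeff (b : HilbertBasis ι ℂ H) {α : Type*} {l : Filter α}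
    {X : α → H} {x ψ : H} {m : α → ι → ℂ} {m₀ : ι → ℂ} {C : ℝ}
    (hX : ∀ᶠ a in l, ∀ i, ⟪b i, X a⟫_ℂ = m a i * ⟪b i, ψ⟫_ℂ)
    (hx : ∀ i, ⟪b i, x⟫_ℂ = m₀ i * ⟪b i, ψ⟫_ℂ)
    (hC : ∀ᶠ a in l, ∀ i, ‖m a i - m₀ i‖ ≤ C)
    (hm : ∀ i, Tendsto (fun a => m a i) l (𝓝 (m₀ i))) : Tendsto X l (𝓝 x) := by
  have h1 : Tendsto (fun a => ∑' i, (‖m a i - m₀ i‖ * ‖⟪b i, ψ⟫_ℂ‖) ^ 2) l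
      (𝓝 (∑' _ : ι, (0 : ℝ))) := by
    refine tendsto_tsum_of_dominated_convergence
      ((b.hasSum_norm_sq ψ).summable.mul_left (C ^ 2)) (fun i => ?_) ?_
    · have h2 : Tendsto (fun a => ‖m a i - m₀ i‖) l (𝓝 0) := by
        simpa using ((hm i).sub_const (m₀ i)).norm
      simpa using (h2.mul_const ‖⟪b i, ψ⟫_ℂ‖).pow 2
    · filter_upwards [hC] with a ha i
      rw [Real.norm_of_nonneg (by positivity), mul_pow]
      have := ha i
      gcongr
  rw [tsum_zero] at h1
  rw [tendsto_iff_norm_sub_tendsto_zero]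
  have h3 : Tendsto (fun a => ‖X a - x‖ ^ 2) l (𝓝 0) := by
    refine h1.congr' ?_
    filter_upwards [hX] with a ha
    rw [← (b.hasSum_norm_sq (X a - x)).tsum_eq]
    refine tsum_congr fun i => ?_
    rw [inner_sub_right, ha, hx, ← sub_mul, norm_mul]
  have h4 := h3.sqrt
  simpa [Real.sqrt_sq] using h4

/-- The point is a bound uniform in `a`, because the eigenvalues are unbounded. It rests on `y
e^{-y} ≤ 1`. -/
theorem abs_exp_slope_le {a s t : ℝ} (ha : 0 ≤ a) (hs : 0 < s) (ht : 0 < t) :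
    |Real.exp (-(a * s)) - Real.exp (-(a * t))| ≤ |s - t| / min s t := by
  wlog hst : s ≤ t generalizing s t
  · rw [abs_sub_comm, abs_sub_comm s t, min_comm]
    exact this ht hs (le_of_not_ge hst)
  rw [min_eq_left hst, abs_of_nonneg (sub_nonneg.2 (Real.exp_le_exp.2 (by nlinarith))),
    abs_sub_comm, abs_of_nonneg (sub_nonneg.2 hst), le_div_iff₀ hs]
  have h1 : Real.exp (-(a * t)) = Real.exp (-(a * s)) * Real.exp (-(a * (t - s))) := by
    rw [← Real.exp_add]; ring_nf
  have h2 := Real.add_one_le_exp (-(a * (t - s)))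
  have h3 : a * s * Real.exp (-(a * s)) ≤ 1 := by
    have := Real.add_one_le_exp (a * s)
    rw [Real.exp_neg, ← div_eq_mul_inv, div_le_one (Real.exp_pos _)]
    linarith
  have h4 := Real.exp_pos (-(a * s))
  have h5 : Real.exp (-(a * s)) * (1 - Real.exp (-(a * (t - s)))) ≤
      Real.exp (-(a * s)) * (a * (t - s)) := by gcongr; linarith
  rw [h1]
  nlinarith [mul_le_mul_of_nonneg_right h3 (sub_nonneg.2 hst), mul_le_mul_of_nonneg_right h5 hs.le]

variable (b : HilbertBasis ι ℂ H) {lam : ι → ℝ} {G : Submodule ℂ (H × H)}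

/-- The partial sums of the two eigenfunction expansions form pairs in `G`, and they converge
jointly to `(x, y)`. -/
theorem HilbertBasis.mem_closure_graph (hG : ∀ i, (b i, (lam i : ℂ) • b i) ∈ G) {x y : H}
    (hxy : ∀ i, ⟪b i, y⟫_ℂ = lam i * ⟪b i, x⟫_ℂ) : (x, y) ∈ closure (G : Set (H × H)) := by
  have h1 := b.hasSum_repr x
  have h2 := b.hasSum_repr y
  simp only [b.repr_apply_apply] at h1 h2
  refine mem_closure_of_tendsto (h1.prodMk h2) (Eventually.of_forall fun s => ?_)
  refine Submodule.sum_mem _ fun i _ => ?_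
  have h3 : (⟪b i, x⟫_ℂ • b i, ⟪b i, y⟫_ℂ • b i) = ⟪b i, x⟫_ℂ • (b i, (lam i : ℂ) • b i) := by
    rw [hxy, Prod.smul_mk, smul_smul, mul_comm]
  rw [h3]
  exact Submodule.smul_mem _ _ (hG i)

theorem HilbertBasis.exists_heat (hlam : ∀ i, 0 ≤ lam i)
    (hG : ∀ i, (b i, (lam i : ℂ) • b i) ∈ G) {c : ℝ} (hc : 0 < c) (ψ : H) :
    ∃ Ψ : H, ∃ u : ℝ → H, ContinuousOn u (Set.Ici 0) ∧ u 0 = ψ ∧ u 1 = Ψ ∧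
      ∀ t : ℝ, 0 < t → ∃ w : H, (u t, w) ∈ closure (G : Set (H × H)) ∧
        HasDerivAt u (-((c : ℂ) • w)) t := by
  have hcl : ∀ i, 0 ≤ c * lam i := fun i => mul_nonneg hc.le (hlam i)
  have hle : ∀ t, 0 ≤ t → ∀ i, ‖((Real.exp (-(c * lam i * t)) : ℝ) : ℂ)‖ ≤ 1 := fun t ht i => by
    rw [Complex.norm_real, Real.norm_of_nonneg (Real.exp_pos _).le, Real.exp_le_one_iff]
    have := mul_nonneg (hcl i) ht
    linarith
  have hex : ∀ t : ℝ, ∃ x : H, 0 ≤ t →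
      ∀ i, ⟪b i, x⟫_ℂ = ((Real.exp (-(c * lam i * t)) : ℝ) : ℂ) * ⟪b i, ψ⟫_ℂ := fun t => by
    by_cases ht : 0 ≤ t
    · obtain ⟨x, hx⟩ := b.exists_multiplier (hle t ht) ψ
      exact ⟨x, fun _ => hx⟩
    · exact ⟨0, fun h => absurd h ht⟩
  choose u hu using hex
  refine ⟨u 1, u, fun t ht => ?_, ?_, rfl, fun t ht => ?_⟩
  · refine b.tendsto_of_coeff (C := 2) (m := fun s i => ((Real.exp (-(c * lam i * s)) : ℝ) : ℂ))
      (eventually_mem_nhdsWithin.mono fun s hs => hu s hs) (hu t ht)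
      (eventually_mem_nhdsWithin.mono fun s hs i => ?_) fun i => ?_
    · exact (norm_sub_le _ _).trans (by linarith [hle s hs i, hle t ht i])
    · have : Continuous fun s : ℝ => ((Real.exp (-(c * lam i * s)) : ℝ) : ℂ) := by fun_prop
      exact this.continuousAt.continuousWithinAt
  · exact b.ext_inner fun i => by simp [hu 0 le_rfl i]
  -- Smoothing: `λ e^{-cλt} ≤ 1 / (c t)`, so `u t` lies in the domain for `t > 0` even when `ψ` does
  -- not.
  · have hw : ∀ i, ‖((lam i * Real.exp (-(c * lam i * t)) : ℝ) : ℂ)‖ ≤ 1 / (c * t) := fun i => by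
      rw [Complex.norm_real, Real.norm_of_nonneg (mul_nonneg (hlam i) (Real.exp_pos _).le),
        le_div_iff₀ (mul_pos hc ht), Real.exp_neg]
      have h1 := Real.add_one_le_exp (c * lam i * t)
      have h2 : lam i * (Real.exp (c * lam i * t))⁻¹ * (c * t) =
          (c * lam i * t) / Real.exp (c * lam i * t) := by
        rw [div_eq_mul_inv]; ring
      rw [h2, div_le_one (Real.exp_pos _)]
      linarith
    obtain ⟨w, hwc⟩ := b.exists_multiplier hw ψ
    refine ⟨w, b.mem_closure_graph hG fun i => ?_, ?_⟩
    · rw [hwc, hu t ht.le]; push_cast; ring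
    rw [hasDerivAt_iff_tendsto_slope]
    have hev : ∀ᶠ s in 𝓝[≠] t, t / 2 < s :=
      (eventually_gt_nhds (half_lt_self ht)).filter_mono nhdsWithin_le_nhds
    have hs_ne : ∀ᶠ s in 𝓝[≠] t, s ≠ t := eventually_mem_nhdsWithin
    -- The first summand of `C` bounds the difference quotients for `s > t / 2`, the second bounds
    -- their limit.
    refine b.tendsto_of_coeff (ψ := ψ) (C := 1 / (t / 2) + c * (1 / (c * t)))
      (m := fun s i => ((slope (fun s => Real.exp (-(c * lam i * s))) t s : ℝ) : ℂ))
      (m₀ := fun i => ((-(c * (lam i * Real.exp (-(c * lam i * t)))) : ℝ) : ℂ))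
      (hev.mono fun s hs i => ?_) (fun i => ?_) ((hev.and hs_ne).mono fun s hs i => ?_) fun i => ?_
    · rw [slope_def_module, inner_smul_right_eq_smul, inner_sub_right, hu t ht.le,
        hu s (by linarith), slope_def_module, smul_eq_mul, Complex.real_smul]
      push_cast
      ring
    · rw [inner_neg_right, inner_smul_right, hwc]; push_cast; ring
    · obtain ⟨hs, hne⟩ := hs
      have hspos : 0 < s := by linarith
      refine (norm_sub_le _ _).trans (add_le_add ?_ ?_)
      · rw [Complex.norm_real, slope_def_field, norm_div, Real.norm_eq_abs, Real.norm_eq_abs,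
          div_le_iff₀ (abs_pos.2 (sub_ne_zero.2 hne))]
        refine (abs_exp_slope_le (hcl i) hspos ht).trans ?_
        rw [div_eq_mul_one_div, mul_comm]
        gcongr
        exact le_min hs.le (by linarith)
      · have := hw i
        rw [Complex.norm_real] at this
        rw [Complex.norm_real, norm_neg, norm_mul, Real.norm_of_nonneg hc.le]
        gcongr
    · have h1 : HasDerivAt (fun s => Real.exp (-(c * lam i * s)))
          (-(c * (lam i * Real.exp (-(c * lam i * t))))) t := by
        have := (((hasDerivAt_id t).const_mul (c * lam i)).neg).exp
        simp only [id, mul_one] at this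
        refine this.congr_deriv ?_
        rw [Pi.neg_apply]
        ring
      exact (Complex.continuous_ofReal.tendsto _).comp (hasDerivAt_iff_tendsto_slope.1 h1)

/-- For each `i` the relation in `hsymm` is a closed condition, so it passes to the closure of the
graph. Then `e^{cλt} ⟪b i, u t⟫` has zero derivative for `t > 0`, for any solution `u`. -/
theorem HilbertBasis.heat_coeff
    (hsymm : ∀ p ∈ G, ∀ i, ⟪b i, p.2⟫_ℂ = lam i * ⟪b i, p.1⟫_ℂ) {c : ℝ} {ψ Ψ : H}
    (hu : ∃ u : ℝ → H, ContinuousOn u (Set.Ici 0) ∧ u 0 = ψ ∧ u 1 = Ψ ∧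
      ∀ t : ℝ, 0 < t → ∃ w : H, (u t, w) ∈ closure (G : Set (H × H)) ∧
        HasDerivAt u (-((c : ℂ) • w)) t) (i : ι) :
    ⟪b i, Ψ⟫_ℂ = ((Real.exp (-(c * lam i)) : ℝ) : ℂ) * ⟪b i, ψ⟫_ℂ := by
  obtain ⟨u, hcont, rfl, rfl, hu⟩ := hu
  have hcl : ∀ p ∈ closure (G : Set (H × H)), ⟪b i, p.2⟫_ℂ = lam i * ⟪b i, p.1⟫_ℂ := by
    have hclosed : IsClosed {p : H × H | ⟪b i, p.2⟫_ℂ = lam i * ⟪b i, p.1⟫_ℂ} :=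
      isClosed_eq (by fun_prop) (by fun_prop)
    exact fun p hp => closure_minimal (fun q hq => hsymm q hq i) hclosed hp
  set g : ℝ → ℂ := fun t => ((Real.exp (c * lam i * t) : ℝ) : ℂ) * ⟪b i, u t⟫_ℂ with hg
  have hgc : ContinuousOn g (Set.Ici 0) := by
    refine ContinuousOn.mul (Continuous.continuousOn (by fun_prop)) ?_
    exact (innerSL ℂ (b i)).continuous.comp_continuousOn hcont
  have hgd : ∀ t, 0 < t → HasDerivAt g 0 t := fun t ht => by
    obtain ⟨w, hw, hd⟩ := hu t ht
    have h1 : HasDerivAt (fun t : ℝ => ((Real.exp (c * lam i * t) : ℝ) : ℂ))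
        ((Real.exp (c * lam i * t) * (c * lam i) : ℝ) : ℂ) t := by
      refine HasDerivAt.ofReal_comp ?_
      simpa using ((hasDerivAt_id t).const_mul (c * lam i)).exp
    have h2 : HasDerivAt (fun t => ⟪b i, u t⟫_ℂ) ⟪b i, -((c : ℂ) • w)⟫_ℂ t :=
      ((innerSL ℂ (b i)).restrictScalars ℝ).hasFDerivAt.comp_hasDerivAt t hd
    refine (h1.mul h2).congr_deriv ?_
    rw [inner_neg_right, inner_smul_right, hcl _ hw]
    push_cast
    ring
  -- The equation is available only for `t > 0`; constancy on `[ε, 1]` is extended to `0` by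
  -- continuity.
  have hconst : ∀ ε ∈ Set.Ioc (0 : ℝ) 1, g 1 = g ε := fun ε hε =>
    constant_of_has_deriv_right_zero (f := g) (a := ε) (b := 1)
      (hgc.mono fun x hx => le_trans hε.1.le hx.1)
      (fun x hx => (hgd x (hε.1.trans_le hx.1)).hasDerivWithinAt) 1 ⟨hε.2, le_rfl⟩
  have hlim : Tendsto g (𝓝[>] 0) (𝓝 (g 0)) :=
    (hgc 0 Set.self_mem_Ici).mono_left (nhdsWithin_mono _ Set.Ioi_subset_Ici_self)
  have hlim2 : Tendsto g (𝓝[>] 0) (𝓝 (g 1)) := by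
    refine tendsto_const_nhds.congr' ?_
    filter_upwards [Ioc_mem_nhdsGT (zero_lt_one (α := ℝ))] with ε hε using hconst ε hε
  have h := tendsto_nhds_unique hlim2 hlim
  simp only [hg, mul_one, mul_zero, Real.exp_zero, Complex.ofReal_one, one_mul] at h
  rw [← h, ← mul_assoc, ← Complex.ofReal_mul, ← Real.exp_add]
  simp

end DiagonalHeat

/-- A symmetric operator which preserves the finite-dimensional subspaces `Q'` and `Q` is
diagonalizable on the part of `Q` orthogonal to `Q'`. -/
theorem exists_orthonormal_eigenvectors {A H : Type*} [AddCommGroup A] [Module ℂ A]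
    [NormedAddCommGroup H] [InnerProductSpace ℂ H] (e : A →ₗ[ℂ] H) (S : A →ₗ[ℂ] A)
    (hS : ∀ f g, ⟪e (S f), e g⟫_ℂ = ⟪e f, e (S g)⟫_ℂ) (Q' Q : Submodule ℂ A)
    [FiniteDimensional ℂ Q] (hQ' : ∀ f ∈ Q', S f ∈ Q') (hQ : ∀ f ∈ Q, S f ∈ Q) :
    ∃ (N : ℕ) (b : Fin N → H) (lam : Fin N → ℝ), Orthonormal ℂ b ∧
      Submodule.span ℂ (Set.range b) = (Q'.map e)ᗮ ⊓ Q.map e ∧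
      ∀ i, ∃ f ∈ Q, e f = b i ∧ e (S f) = (lam i : ℂ) • b i := by
  set W : Submodule ℂ H := (Q'.map e)ᗮ ⊓ Q.map e with hW
  have : FiniteDimensional ℂ W := Submodule.finiteDimensional_inf_right _ _
  have hker : ∀ f, e f = 0 → e (S f) = 0 := fun f hf => by
    rw [← inner_self_eq_zero (𝕜 := ℂ), hS, hf, inner_zero_left]
  -- `e` may have a kernel, since different polynomials can agree on the sphere. A linear section
  -- chooses representatives, and `hS` makes the resulting operator symmetric whatever the choice.
  obtain ⟨s, hs⟩ := (e.submoduleMap Q).exists_rightInverse_of_surjective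
    (LinearMap.range_eq_top.2 (e.submoduleMap_surjective Q))
  have hs' : ∀ w : Q.map e, e (s w) = w := fun w =>
    congrArg Subtype.val (LinearMap.congr_fun hs w)
  let T₀ : W →ₗ[ℂ] H := e ∘ₗ S ∘ₗ Q.subtype ∘ₗ s ∘ₗ Submodule.inclusion inf_le_right
  have hT₀ : ∀ (w : W), ∃ f ∈ Q, e f = w ∧ e (S f) = T₀ w := fun w =>
    ⟨s (Submodule.inclusion inf_le_right w), Subtype.property _, hs' _, rfl⟩
  have hmem : ∀ w, T₀ w ∈ W := fun w => by
    obtain ⟨f, hf, hfw, hSf⟩ := hT₀ w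
    rw [← hSf]
    refine ⟨?_, Submodule.mem_map_of_mem (hQ f hf)⟩
    rw [SetLike.mem_coe, Submodule.mem_orthogonal]
    rintro _ ⟨g, hg, rfl⟩
    -- By symmetry, the invariance of `Q'` passes to its orthogonal complement.
    rw [← hS, hfw]
    exact (Submodule.mem_orthogonal _ _).1 w.2.1 _ (Submodule.mem_map_of_mem (hQ' g hg))
  let T : W →ₗ[ℂ] W := T₀.codRestrict W hmem
  have hT : T.IsSymmetric := fun w w' => by
    obtain ⟨f, -, hfw, hSf⟩ := hT₀ w
    obtain ⟨f', -, hfw', hSf'⟩ := hT₀ w'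
    change ⟪T₀ w, (w' : H)⟫_ℂ = ⟪(w : H), T₀ w'⟫_ℂ
    rw [← hSf, ← hSf', ← hfw, ← hfw', hS]
  let B := hT.eigenvectorBasis rfl
  refine ⟨_, fun i => (B i : H), hT.eigenvalues rfl,
    B.orthonormal.comp_linearIsometry W.subtypeₗᵢ, ?_, fun i => ?_⟩
  · have h1 : (Set.range fun i => (B i : H)) = W.subtype '' Set.range B := by
      rw [← Set.range_comp]; rfl
    rw [h1, Submodule.span_image, ← B.coe_toBasis, Module.Basis.span_eq, Submodule.map_top,
      Submodule.range_subtype]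
  · obtain ⟨f, hf, hfw, hSf⟩ := hT₀ (B i)
    refine ⟨f, hf, hfw, hSf.trans ?_⟩
    exact congrArg Subtype.val (hT.apply_eigenvectorBasis rfl i)

namespace MonopoleSphere

/-! ### Diagonalization of `Ĵ²` -/

section Diagonalization

variable {n : ℕ} {r : ℝ}

/-- The coordinate functions on the sphere. -/
def sphereCoord (r : ℝ) (k : Fin 3) : C(RealSphere r, ℝ) :=
  ⟨fun x => (x : E3) k, by fun_prop⟩

/-- Quantifying over every polynomial `f` inside the induction lets a product `g₁ g₂` act as two
successive multiplications. -/
theorem exists_polyFun_mul {g : C(RealSphere r, ℝ)}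
    (hg : g ∈ Algebra.adjoin ℝ (Set.range (sphereCoord r))) :
    ∀ (d : ℕ), ∀ f ∈ polyFun n d, ∃ d', ∃ f' ∈ polyFun n d', ∀ x : RealSphere r,
      f'.1 x = ((g x : ℝ) : ℂ) • f.1 x := by
  induction hg using Algebra.adjoin_induction with
  | mem g hg =>
    obtain ⟨k, rfl⟩ := hg
    exact fun d f hf => ⟨d + 1, mulX k f, mulX_mem hf k, fun x => rfl⟩
  | algebraMap c => exact fun d f hf => ⟨d, (c : ℂ) • f, Submodule.smul_mem _ _ hf, fun x => rfl⟩
  | add g₁ g₂ _ _ h₁ h₂ =>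
    intro d f hf
    obtain ⟨d₁, f₁, hf₁, hx₁⟩ := h₁ d f hf
    obtain ⟨d₂, f₂, hf₂, hx₂⟩ := h₂ d f hf
    refine ⟨max d₁ d₂, f₁ + f₂, add_mem (polyFun_mono (le_max_left _ _) hf₁)
      (polyFun_mono (le_max_right _ _) hf₂), fun x => ?_⟩
    rw [Submodule.coe_add, Pi.add_apply, hx₁, hx₂, ContinuousMap.add_apply, Complex.ofReal_add,
      add_smul]
  | mul g₁ g₂ _ _ h₁ h₂ =>
    intro d f hf
    obtain ⟨d₂, f₂, hf₂, hx₂⟩ := h₂ d f hf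
    obtain ⟨d₁, f₁, hf₁, hx₁⟩ := h₁ d₂ f₂ hf₂
    refine ⟨d₁, f₁, hf₁, fun x => ?_⟩
    rw [hx₁, hx₂, ContinuousMap.mul_apply, Complex.ofReal_mul, mul_smul]

theorem separatesPoints_sphereCoord (r : ℝ) :
    (Algebra.adjoin ℝ (Set.range (sphereCoord r))).SeparatesPoints := by
  intro x y hxy
  have h : ∃ k, (x : E3) k ≠ (y : E3) k := by
    by_contra! h
    exact hxy (Subtype.ext (PiLp.ext h))
  obtain ⟨k, hk⟩ := h
  exact ⟨_, ⟨sphereCoord r k, Algebra.subset_adjoin ⟨k, rfl⟩, rfl⟩, hk⟩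

/-- The polynomials are dense in `L²`. -/
theorem topologicalClosure_polyFun (r : ℝ) (n : ℕ) :
    (⨆ d, (polyFun n d).map (restrict r)).topologicalClosure = ⊤ := by
  set K := (⨆ d, (polyFun n d).map (restrict r)).topologicalClosure with hK
  have hpoly : ∀ d, ∀ f ∈ polyFun n d, restrict r f ∈ K := fun d f hf =>
    Submodule.le_topologicalClosure _
      (Submodule.mem_iSup_of_mem d (Submodule.mem_map_of_mem hf))
  let sc (v : Spin n) : C(ℝ, Spin n) := ⟨fun t => (t : ℂ) • v, by fun_prop⟩
  have hscalar : ∀ (v : Spin n) (g : C(RealSphere r, ℝ)),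
      ContinuousMap.toLp 2 (surfaceMeasure r) ℂ ((sc v).comp g) ∈ K := by
    intro v g
    have hclosed : IsClosed {g : C(RealSphere r, ℝ) |
        ContinuousMap.toLp 2 (surfaceMeasure r) ℂ ((sc v).comp g) ∈ K} :=
      (Submodule.isClosed_topologicalClosure _).preimage
        ((ContinuousMap.toLp 2 (surfaceMeasure r) ℂ).continuous.comp
          (ContinuousMap.continuous_postcomp (sc v)))
    have hsub : (Algebra.adjoin ℝ (Set.range (sphereCoord r)) : Set C(RealSphere r, ℝ)) ⊆
        {g | ContinuousMap.toLp 2 (surfaceMeasure r) ℂ ((sc v).comp g) ∈ K} := by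
      intro g hg
      obtain ⟨d, f, hf, hx⟩ := exists_polyFun_mul hg 1 (constFun v) (constFun_mem v 0)
      have h1 : ContinuousMap.toLp 2 (surfaceMeasure r) ℂ ((sc v).comp g) = restrict r f := by
        change _ = ContinuousMap.toLp 2 (surfaceMeasure r) ℂ _
        congr 1
        exact ContinuousMap.ext fun x => (hx x).symm
      rw [Set.mem_ofPred_eq, h1]
      exact hpoly d f hf
    have hdense := ContinuousMap.subalgebra_topologicalClosure_eq_top_of_separatesPoints _
      (separatesPoints_sphereCoord r)
    have hg : g ∈ (Algebra.adjoin ℝ (Set.range (sphereCoord r))).topologicalClosure := by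
      rw [hdense]; trivial
    exact closure_minimal hsub hclosed hg
  have hcont : ∀ f : C(RealSphere r, Spin n),
      ContinuousMap.toLp 2 (surfaceMeasure r) ℂ f ∈ K := by
    intro f
    let e := stdOrthonormalBasis ℂ (Spin n)
    -- Real and imaginary parts of the coordinates reduce `V`-valued functions to real ones, where
    -- Stone–Weierstrass has been applied.
    have hf : f = ∑ i, ((sc (e i)).comp ⟨fun x => (⟪e i, f x⟫_ℂ).re, by fun_prop⟩ +
        (sc (Complex.I • e i)).comp ⟨fun x => (⟪e i, f x⟫_ℂ).im, by fun_prop⟩) := by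
      refine ContinuousMap.ext fun x => ?_
      rw [ContinuousMap.sum_apply]
      conv_lhs => rw [← e.sum_repr' (f x)]
      refine Finset.sum_congr rfl fun i _ => ?_
      change _ = (((⟪e i, f x⟫_ℂ).re : ℝ) : ℂ) • e i +
        (((⟪e i, f x⟫_ℂ).im : ℝ) : ℂ) • (Complex.I • e i)
      rw [smul_smul, ← add_smul, Complex.re_add_im]
    rw [hf, map_sum]
    refine Submodule.sum_mem _ fun i _ => ?_
    rw [map_add]
    exact add_mem (hscalar _ _) (hscalar _ _)
  refine Submodule.eq_top_iff'.2 fun x => ?_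
  have hd := ContinuousMap.toLp_denseRange (p := 2) (Spin n) (surfaceMeasure r) ℂ (by simp) x
  refine closure_minimal ?_ (Submodule.isClosed_topologicalClosure _) hd
  rintro _ ⟨f, rfl⟩
  exact hcont f

theorem norm_restrict_spinOp_le (A : Spin n →L[ℂ] Spin n) (f : SmoothFun n) :
    ‖restrict r (spinOp A f)‖ ≤ ‖A‖ * ‖restrict r f‖ := by
  refine Lp.norm_le_mul_norm_of_ae_le_mul ?_
  filter_upwards [coeFn_restrict (r := r) f, coeFn_restrict (r := r) (spinOp A f)] with x h1 h2
  rw [h1, h2]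
  exact A.le_opNorm _

theorem restrict_normSqOp (f : SmoothFun n) :
    restrict r (normSqOp f) = ((r ^ 2 : ℝ) : ℂ) • restrict r f := by
  rw [← map_smul]
  refine restrict_congr fun x => ?_
  have h1 := EuclideanSpace.norm_sq_eq (x : E3)
  rw [mem_sphere_zero_iff_norm.1 x.2] at h1
  simp only [Real.norm_eq_abs, sq_abs, Fin.sum_univ_three] at h1
  simp only [normSqOp, Fin.sum_univ_three, LinearMap.add_apply, LinearMap.comp_apply,
    Submodule.coe_add, Pi.add_apply, mulX_apply, Submodule.coe_smul, Pi.smul_apply]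
  rw [h1]
  push_cast
  module

theorem inner_restrict_angularSqOp_self (hr : 0 < r) (ħ : ℝ) (f : SmoothFun n) :
    ⟪restrict r f, restrict r (angularSqOp ħ f)⟫_ℂ =
      ((∑ j, ‖restrict r (angularOp ħ j f)‖ ^ 2 : ℝ) : ℂ) := by
  simp only [angularSqOp, LinearMap.coe_sum, Finset.sum_apply, LinearMap.comp_apply, map_sum,
    inner_sum]
  push_cast
  exact Finset.sum_congr rfl fun j _ =>
    (inner_restrict_angularOp hr ħ j f _).symm.trans (inner_self_eq_norm_sq_to_K _)

/-- The lower bound for the eigenvalues of `Ĵ²` on polynomials of degree `d`. -/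
theorem le_eigenvalue (hr : 0 < r) (ħ : ℝ) {d : ℕ} {f : SmoothFun n}
    (hf : f ∈ polyFun n (d + 1)) (hnorm : ‖restrict r f‖ = 1)
    (horth : restrict r f ∈ ((polyFun n d).map (restrict r))ᗮ) {lam : ℝ}
    (hlam : restrict r (angularSqOp ħ f) = (lam : ℂ) • restrict r f) :
    0 ≤ lam ∧ ħ ^ 2 * (d * (d + 1)) / 2 - ∑ j, ‖sigma ħ n j‖ ^ 2 ≤ lam := by
  have h1 := inner_restrict_angularSqOp_self hr ħ f
  rw [hlam, inner_smul_right, inner_self_eq_norm_sq_to_K, hnorm] at h1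
  have h2 : lam = ∑ j, ‖restrict r (angularOp ħ j f)‖ ^ 2 := by
    have : (lam : ℂ) = ((∑ j, ‖restrict r (angularOp ħ j f)‖ ^ 2 : ℝ) : ℂ) := by
      rw [← h1]; simp
    exact_mod_cast this
  -- The lower-degree corrections to `∑ L_j²` are orthogonal to `f`, so this holds exactly.
  have h3 : ħ ^ 2 * (d * (d + 1)) = ∑ j, ‖restrict r (orbitalOp ħ j f)‖ ^ 2 := by
    obtain ⟨g, hg, h, hh, hsq⟩ := orbitalOp_sq_poly hf ħ
    have h4 : ⟪restrict r f, restrict r (∑ j, orbitalOp ħ j (orbitalOp ħ j f))⟫_ℂ =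
        ((∑ j, ‖restrict r (orbitalOp ħ j f)‖ ^ 2 : ℝ) : ℂ) := by
      simp only [map_sum, inner_sum]
      push_cast
      exact Finset.sum_congr rfl fun j _ =>
        (inner_restrict_orbitalOp hr ħ j f _).symm.trans (inner_self_eq_norm_sq_to_K _)
    have h5 : ∀ g ∈ polyFun n d, ⟪restrict r f, restrict r g⟫_ℂ = 0 := fun g hg =>
      (Submodule.mem_orthogonal' _ _).1 horth _ (Submodule.mem_map_of_mem hg)
    rw [hsq, map_add, map_add, map_smul, restrict_normSqOp, inner_add_right, inner_add_right,
      inner_smul_right, inner_smul_right, h5 g hg, h5 h hh, inner_self_eq_norm_sq_to_K,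
      hnorm] at h4
    have : ((ħ ^ 2 * (d * (d + 1)) : ℝ) : ℂ) =
        ((∑ j, ‖restrict r (orbitalOp ħ j f)‖ ^ 2 : ℝ) : ℂ) := by
      rw [← h4]; simp
    exact_mod_cast this
  refine ⟨h2 ▸ Finset.sum_nonneg fun _ _ => by positivity, ?_⟩
  rw [h2, h3, Finset.sum_div, ← Finset.sum_sub_distrib]
  refine Finset.sum_le_sum fun j _ => ?_
  have h6 : restrict r (orbitalOp ħ j f) =
      restrict r (angularOp ħ j f) - restrict r (spinOp (sigma ħ n j) f) := by
    rw [← map_sub, angularOp, LinearMap.add_apply, add_sub_cancel_right]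
  have h7 := norm_restrict_spinOp_le (r := r) (sigma ħ n j) f
  rw [hnorm, mul_one] at h7
  have h8 : ‖restrict r (orbitalOp ħ j f)‖ ≤ ‖restrict r (angularOp ħ j f)‖ + ‖sigma ħ n j‖ := by
    rw [h6]; exact (norm_sub_le _ _).trans (by gcongr)
  have h9 := pow_le_pow_left₀ (norm_nonneg _) h8 2
  -- From `‖L_j f‖ ≤ ‖Ĵ_j f‖ + ‖σ_j‖` follows `‖L_j f‖² / 2 ≤ ‖Ĵ_j f‖² + ‖σ_j‖²`.
  nlinarith [sq_nonneg (‖restrict r (angularOp ħ j f)‖ - ‖sigma ħ n j‖)]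

/-- There is a Hilbert basis of `L²` consisting of polynomial eigenfunctions of `Ĵ²`. -/
theorem exists_eigenbasis (hr : 0 < r) (ħ : ℝ) (n : ℕ) :
    ∃ (N : ℕ → ℕ) (b : HilbertBasis (Σ d, Fin (N d)) ℂ (L2 r n)) (lam : (Σ d, Fin (N d)) → ℝ)
      (f : (Σ d, Fin (N d)) → SmoothFun n) (C : ℝ), ∀ i,
      f i ∈ polyFun n (i.1 + 1) ∧ restrict r (f i) = b i ∧
      restrict r (angularSqOp ħ (f i)) = (lam i : ℂ) • b i ∧
      0 ≤ lam i ∧ ħ ^ 2 * (i.1 * (i.1 + 1)) / 2 - C ≤ lam i := by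
  -- The block with index `d` diagonalizes `Ĵ²` on degree at most `d`, orthogonally to degree less
  -- than `d`.
  have hex := fun d => exists_orthonormal_eigenvectors (restrict (n := n) r) (angularSqOp ħ)
    (inner_restrict_angularSqOp hr ħ) (polyFun n d) (polyFun n (d + 1))
    (fun f hf => angularSqOp_mem hf ħ) (fun f hf => angularSqOp_mem hf ħ)
  choose N b lam hb hspan f hf hfb hSf using hex
  have hmem : ∀ d i, b d i ∈ ((polyFun n d).map (restrict r))ᗮ ⊓
      (polyFun n (d + 1)).map (restrict r) := fun d i => by
    rw [← hspan]; exact Submodule.subset_span ⟨i, rfl⟩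
  have hlt : ∀ d d' i i', d < d' → ⟪b d i, b d' i'⟫_ℂ = 0 := fun d d' i i' h =>
    (Submodule.mem_orthogonal _ _).1 (hmem d' i').1 _
      (Submodule.map_mono (polyFun_mono h) (hmem d i).2)
  have hon : Orthonormal ℂ fun i : Σ d, Fin (N d) => b i.1 i.2 := by
    refine ⟨fun i => (hb i.1).1 i.2, fun ⟨d, i⟩ ⟨d', i'⟩ hne => ?_⟩
    rcases lt_trichotomy d d' with h | rfl | h
    · exact hlt _ _ _ _ h
    · exact (hb d).2 fun h => hne (by rw [show i = i' from h])
    · change ⟪b d i, b d' i'⟫_ℂ = 0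
      rw [← inner_conj_symm, hlt _ _ _ _ h, map_zero]
  set P := Submodule.span ℂ (Set.range fun i : Σ d, Fin (N d) => b i.1 i.2) with hP
  have hle : ∀ d, (polyFun n d).map (restrict r) ≤ P := by
    intro d
    induction d with
    | zero => rw [polyFun, Submodule.map_bot]; exact bot_le
    | succ d ih =>
      rw [← Submodule.sup_orthogonal_inf_of_hasOrthogonalProjection
        (Submodule.map_mono (polyFun_le_succ d) :
          (polyFun n d).map (restrict r) ≤ (polyFun n (d + 1)).map (restrict r)), ← hspan]
      refine sup_le ih (Submodule.span_mono ?_)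
      rintro _ ⟨i, rfl⟩
      exact ⟨⟨d, i⟩, rfl⟩
  have htop : ⊤ ≤ P.topologicalClosure := by
    rw [← topologicalClosure_polyFun r n]
    exact Submodule.topologicalClosure_mono (iSup_le hle)
  refine ⟨N, HilbertBasis.mk hon htop, fun i => lam i.1 i.2, fun i => f i.1 i.2,
    ∑ j, ‖sigma ħ n j‖ ^ 2, fun i => ?_⟩
  rw [HilbertBasis.coe_mk]
  refine ⟨hf _ _, hfb _ _, hSf _ _, le_eigenvalue hr ħ (hf i.1 i.2) ?_ ?_ ?_⟩
  · rw [hfb]; exact (hb _).1 _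
  · rw [hfb]; exact (hmem _ _).1
  · rw [hfb]; exact hSf _ _

end Diagonalization

end MonopoleSphere

namespace MonopoleSphere

/-! ### Complexified great circles -/

section GreatCircles

variable {n : ℕ} {r : ℝ}

/-- The great circle through `r u` and `r v`, with a complex parameter. -/
def greatCircle (r : ℝ) (u v : E3) (θ : ℂ) : Fin 3 → ℂ :=
  fun k => r * (Complex.cos θ * (u k : ℂ) + Complex.sin θ * (v k : ℂ))

theorem inner_E3 (u v : E3) : ⟪u, v⟫_ℝ = u 0 * v 0 + u 1 * v 1 + u 2 * v 2 := by
  simp only [PiLp.inner_apply, Fin.sum_univ_three, RCLike.inner_apply, conj_trivial]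
  ring

theorem norm_sq_E3 (u : E3) : ‖u‖ ^ 2 = u 0 ^ 2 + u 1 ^ 2 + u 2 ^ 2 := by
  rw [← real_inner_self_eq_norm_sq, inner_E3]; ring

theorem greatCircle_mem {u v : E3} (hu : ‖u‖ = 1) (hv : ‖v‖ = 1) (huv : ⟪u, v⟫_ℝ = 0) (θ : ℂ) :
    greatCircle r u v θ ∈ complexSphere r := by
  have h1 := norm_sq_E3 u
  have h2 := norm_sq_E3 v
  rw [inner_E3] at huv
  rw [hu] at h1
  rw [hv] at h2
  have h1' : (1 : ℂ) ^ 2 = (u 0 : ℂ) ^ 2 + (u 1 : ℂ) ^ 2 + (u 2 : ℂ) ^ 2 := by exact_mod_cast h1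
  have h2' : (1 : ℂ) ^ 2 = (v 0 : ℂ) ^ 2 + (v 1 : ℂ) ^ 2 + (v 2 : ℂ) ^ 2 := by exact_mod_cast h2
  have h3' : (u 0 : ℂ) * v 0 + u 1 * v 1 + u 2 * v 2 = 0 := by exact_mod_cast huv
  have h4 := Complex.sin_sq_add_cos_sq θ
  change greatCircle r u v θ 0 ^ 2 + greatCircle r u v θ 1 ^ 2 + greatCircle r u v θ 2 ^ 2 = _
  simp only [greatCircle]
  linear_combination (-(r : ℂ) ^ 2 * Complex.cos θ ^ 2) * h1' -
    ((r : ℂ) ^ 2 * Complex.sin θ ^ 2) * h2' +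
    (2 * (r : ℂ) ^ 2 * Complex.cos θ * Complex.sin θ) * h3' + (r : ℂ) ^ 2 * h4

theorem differentiable_greatCircle (u v : E3) : Differentiable ℂ (greatCircle r u v) := by
  refine differentiable_pi.2 fun k => ?_
  unfold greatCircle
  fun_prop

theorem greatCircle_ofReal (u v : E3) (θ : ℝ) :
    greatCircle r u v θ = toComplex (r • (Real.cos θ • u + Real.sin θ • v)) := by
  funext k
  simp [greatCircle, toComplex]
  ring

theorem greatCircle_neg (u v : E3) (θ : ℂ) :
    greatCircle r u (-v) (-θ) = greatCircle r u v θ := by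
  funext k
  simp [greatCircle]

theorem mem_sphere_greatCircle (hr : 0 < r) {u v : E3} (hu : ‖u‖ = 1) (hv : ‖v‖ = 1)
    (huv : ⟪u, v⟫_ℝ = 0) (θ : ℝ) :
    r • (Real.cos θ • u + Real.sin θ • v) ∈ Metric.sphere (0 : E3) r := by
  rw [mem_sphere_zero_iff_norm, norm_smul, Real.norm_of_nonneg hr.le]
  have h : ‖Real.cos θ • u + Real.sin θ • v‖ ^ 2 = 1 := by
    rw [norm_add_sq_real, norm_smul, norm_smul, hu, hv, inner_smul_left, inner_smul_right, huv]
    simp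
  rw [pow_eq_one_iff_of_nonneg (norm_nonneg _) two_ne_zero] at h
  rw [h, mul_one]

/-- The degenerate case `y = 0` is needed: it occurs at real points of the complex sphere and for
equal or antipodal points. -/
theorem exists_unit_orthogonal (u y : E3) (huy : ⟪u, y⟫_ℝ = 0) :
    ∃ v : E3, ‖v‖ = 1 ∧ ⟪u, v⟫_ℝ = 0 ∧ y = ‖y‖ • v := by
  have key : ∀ w : E3, w ≠ 0 → ⟪u, w⟫_ℝ = 0 → ∃ v : E3, ‖v‖ = 1 ∧ ⟪u, v⟫_ℝ = 0 ∧ w = ‖w‖ • v :=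
    fun w hw huw => ⟨‖w‖⁻¹ • w, by
      rw [norm_smul, norm_inv, norm_norm, inv_mul_cancel₀ (norm_ne_zero_iff.2 hw)],
      by rw [inner_smul_right, huw, mul_zero],
      (smul_inv_smul₀ (norm_ne_zero_iff.2 hw) w).symm⟩
  by_cases hy : y = 0
  · have hw : ∃ w : E3, w ≠ 0 ∧ ⟪u, w⟫_ℝ = 0 := by
      by_cases h : u 0 = 0 ∧ u 1 = 0
      · exact ⟨EuclideanSpace.single 0 1, by simp, by simp [inner_E3, h.1]⟩
      · refine ⟨!₂[-u 1, u 0, 0], fun h0 => h ?_, by simp [inner_E3]; ring⟩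
        have h1 := congrArg (fun w : E3 => w 0) h0
        have h2 := congrArg (fun w : E3 => w 1) h0
        simp at h1 h2
        exact ⟨h2, h1⟩
    obtain ⟨w, hw, huw⟩ := hw
    obtain ⟨v, hv, huv, -⟩ := key w hw huw
    exact ⟨v, hv, huv, by simp [hy]⟩
  · exact key y hy huy

/-- Every point of the complex sphere lies on a complexified great circle. -/
theorem exists_greatCircle (hr : 0 < r) {a : Fin 3 → ℂ} (ha : a ∈ complexSphere r) :
    ∃ (u v : E3) (t : ℝ), ‖u‖ = 1 ∧ ‖v‖ = 1 ∧ ⟪u, v⟫_ℝ = 0 ∧ 0 ≤ t ∧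
      Real.exp t ≤ 4 / r * ‖a‖ ∧ a = greatCircle r u v (t * Complex.I) := by
  set x : E3 := WithLp.toLp 2 fun k => (a k).re with hx
  set y : E3 := WithLp.toLp 2 fun k => (a k).im with hy
  have ha' : a 0 ^ 2 + a 1 ^ 2 + a 2 ^ 2 = (r : ℂ) ^ 2 := ha
  have hre := congrArg Complex.re ha'
  have him := congrArg Complex.im ha'
  simp [sq] at hre him
  have hxy : ⟪x, y⟫_ℝ = 0 := by
    rw [inner_E3]
    simp only [hx, hy]
    linarith
  have hsq : ‖x‖ ^ 2 = r ^ 2 + ‖y‖ ^ 2 := by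
    rw [norm_sq_E3, norm_sq_E3]
    simp only [hx, hy]
    linarith
  have hxpos : 0 < ‖x‖ := by
    have : 0 < ‖x‖ ^ 2 := by rw [hsq]; positivity
    exact (norm_nonneg x).lt_of_ne' (sq_pos_iff.1 this)
  have hxy' : ⟪‖x‖⁻¹ • x, y⟫_ℝ = 0 := by rw [inner_smul_left, hxy, mul_zero]
  obtain ⟨v, hv, huv, hyv⟩ := exists_unit_orthogonal (‖x‖⁻¹ • x) y hxy'
  -- The defining equation gives `x ⟂ y` and `‖x‖² - ‖y‖² = r²`, so this `t` satisfies `r cosh t =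
  -- ‖x‖` and `r sinh t = ‖y‖`; these are the coefficients at the angle `i t`.
  set t := Real.arsinh (‖y‖ / r) with ht
  have hsinh : r * Real.sinh t = ‖y‖ := by rw [ht, Real.sinh_arsinh]; field_simp
  have hcosh : r * Real.cosh t = ‖x‖ := by
    have h1 := Real.cosh_sq t
    have h2 : (r * Real.cosh t) ^ 2 = ‖x‖ ^ 2 := by rw [hsq, ← hsinh, mul_pow, h1]; ring
    exact (pow_left_inj₀ (mul_nonneg hr.le (Real.cosh_pos t).le) hxpos.le two_ne_zero).1 h2
  -- `‖a‖` is the supremum norm on `ℂ³`, and `√3 ≤ 2`. Applied to both `x` and `y`, it yields the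
  -- constant `4` through `e^t = cosh t + sinh t`.
  have hbound : ∀ w : E3, (∀ k, |w k| ≤ ‖a‖) → ‖w‖ ≤ 2 * ‖a‖ := fun w hw => by
    refine abs_le_of_sq_le_sq' ?_ (by positivity) |>.2
    have h0 := sq_le_sq' (abs_le.1 (hw 0)).1 (abs_le.1 (hw 0)).2
    have h1 := sq_le_sq' (abs_le.1 (hw 1)).1 (abs_le.1 (hw 1)).2
    have h2 := sq_le_sq' (abs_le.1 (hw 2)).1 (abs_le.1 (hw 2)).2
    rw [norm_sq_E3]
    nlinarith
  have hbx := hbound x fun k => (Complex.abs_re_le_norm (a k)).trans (norm_le_pi_norm a k)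
  have hby := hbound y fun k => (Complex.abs_im_le_norm (a k)).trans (norm_le_pi_norm a k)
  refine ⟨‖x‖⁻¹ • x, v, t, ?_, hv, huv, Real.arsinh_nonneg_iff.2 (by positivity), ?_, ?_⟩
  · rw [norm_smul, norm_inv, norm_norm, inv_mul_cancel₀ hxpos.ne']
  · rw [← Real.cosh_add_sinh, div_mul_eq_mul_div, le_div_iff₀ hr]
    linarith
  · funext k
    have h1 : (x k : ℝ) = (r * Real.cosh t) * (‖x‖⁻¹ • x) k := by
      rw [hcosh, PiLp.smul_apply, smul_eq_mul, mul_inv_cancel_left₀ hxpos.ne']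
    have h2 : (y k : ℝ) = (r * Real.sinh t) * v k := by
      rw [hsinh]
      conv_lhs => rw [hyv]
      rfl
    have h3 : a k = (x k : ℂ) + (y k : ℂ) * Complex.I := (Complex.re_add_im (a k)).symm
    rw [h3, h1, h2, greatCircle, Complex.cos_mul_I, Complex.sin_mul_I]
    push_cast
    ring

/-- Two points of the sphere are connected by an arc of a great circle. -/
theorem exists_arc (hr : 0 < r) {x₀ x : E3} (hx₀ : ‖x₀‖ = r) (hx : ‖x‖ = r) :
    ∃ (u v : E3) (θ : ℝ), ‖u‖ = 1 ∧ ‖v‖ = 1 ∧ ⟪u, v⟫_ℝ = 0 ∧ x₀ = r • u ∧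
      x = r • (Real.cos θ • u + Real.sin θ • v) ∧ |θ| ≤ Real.pi / (2 * r) * ‖x - x₀‖ := by
  have hu : ‖r⁻¹ • x₀‖ = 1 := by
    rw [norm_smul, hx₀, norm_inv, Real.norm_of_nonneg hr.le, inv_mul_cancel₀ hr.ne']
  have hp : ‖r⁻¹ • x‖ = 1 := by
    rw [norm_smul, hx, norm_inv, Real.norm_of_nonneg hr.le, inv_mul_cancel₀ hr.ne']
  have hxu : x₀ = r • (r⁻¹ • x₀) := (smul_inv_smul₀ hr.ne' _).symm
  have hxp : x = r • (r⁻¹ • x) := (smul_inv_smul₀ hr.ne' _).symm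
  generalize r⁻¹ • x₀ = u at hu hxu
  generalize r⁻¹ • x = p at hp hxp
  subst hxu hxp
  set s := ⟪u, p⟫_ℝ with hs
  have huu : ⟪u, u⟫_ℝ = 1 := by rw [real_inner_self_eq_norm_sq, hu, one_pow]
  have hy : ⟪u, p - s • u⟫_ℝ = 0 := by
    rw [inner_sub_right, inner_smul_right, huu, mul_one, sub_self]
  obtain ⟨v, hv, huv, hyv⟩ := exists_unit_orthogonal u _ hy
  have hs1 : |s| ≤ 1 := by
    have := abs_real_inner_le_norm u p
    rwa [hu, hp, one_mul] at this
  have hnorm : ‖p - s • u‖ = Real.sqrt (1 - s ^ 2) := by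
    rw [eq_comm, Real.sqrt_eq_iff_mul_self_eq (by nlinarith [abs_le.1 hs1]) (norm_nonneg _), ← sq,
      norm_sub_sq_real, norm_smul, inner_smul_right, real_inner_comm, ← hs, hp, hu, mul_one,
      Real.norm_eq_abs, sq_abs]
    ring
  have hcos : Real.cos (Real.arccos s) = s := Real.cos_arccos (abs_le.1 hs1).1 (abs_le.1 hs1).2
  refine ⟨u, v, Real.arccos s, hu, hv, huv, rfl, ?_, ?_⟩
  · rw [Real.sin_arccos, hcos, ← hnorm, ← hyv, add_sub_cancel]
  · have h0 := Real.arccos_nonneg s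
    have hpi := Real.arccos_le_pi s
    -- Jordan's inequality at half the angle; the chord has length `2 r sin(θ / 2)`.
    have h1 := Real.mul_le_sin (x := Real.arccos s / 2) (by linarith) (by linarith)
    have h2 : ‖r • p - r • u‖ ^ 2 = (2 * r * Real.sin (Real.arccos s / 2)) ^ 2 := by
      have h3 := Real.sin_sq_eq_half_sub (Real.arccos s / 2)
      rw [mul_div_cancel₀ _ two_ne_zero, hcos] at h3
      rw [mul_pow, h3, ← smul_sub, norm_smul, mul_pow, norm_sub_sq_real, real_inner_comm, ← hs, hu,
        hp, Real.norm_eq_abs, sq_abs]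
      ring
    have h4 : 0 ≤ Real.sin (Real.arccos s / 2) :=
      Real.sin_nonneg_of_nonneg_of_le_pi (by linarith) (by linarith [Real.pi_pos])
    rw [pow_left_inj₀ (norm_nonneg _) (by positivity) two_ne_zero] at h2
    rw [h2, abs_of_nonneg h0]
    have h5 : Real.arccos s = Real.pi * (2 / Real.pi * (Real.arccos s / 2)) := by
      field_simp
    have h6 : Real.pi / (2 * r) * (2 * r * Real.sin (Real.arccos s / 2)) =
        Real.pi * Real.sin (Real.arccos s / 2) := by field_simp
    rw [h6]
    conv_lhs => rw [h5]
    gcongr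

end GreatCircles

/-! ### Complex polynomials -/

section ComplexExtension

variable {n : ℕ} {r : ℝ}

/-- Entire functions on `ℂ³` of polynomial growth of degree at most `d` along the curves
`z p + z⁻¹ q`. -/
def IsComplexPoly (d : ℕ) (g : (Fin 3 → ℂ) → Spin n) : Prop :=
  Differentiable ℂ g ∧ ∀ p q : Fin 3 → ℂ, ∃ h : ℂ → Spin n, Differentiable ℂ h ∧
    ∀ z : ℂ, z ≠ 0 → h z = z ^ d • g (z • p + z⁻¹ • q)

/-- Each coordinate factor absorbs one power of `z`, since `z (z p_k + z⁻¹ q_k) = z² p_k + q_k` is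
entire. -/
theorem exists_complexPoly {d : ℕ} {f : SmoothFun n} (hf : f ∈ polyFun n (d + 1)) :
    ∃ g : (Fin 3 → ℂ) → Spin n, IsComplexPoly d g ∧ ∀ x, g (toComplex x) = f.1 x := by
  induction d generalizing f with
  | zero =>
    obtain ⟨v, g, hg, rfl⟩ := exists_of_mem_polyFun_succ hf
    have h0 : ∀ k, g k = 0 := fun k => (Submodule.mem_bot ℂ).1 (hg k)
    refine ⟨fun _ => v, ⟨differentiable_const _, fun p q => ⟨fun _ => v, differentiable_const _,
      fun z _ => by simp⟩⟩, fun x => ?_⟩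
    simp only [h0, map_zero, Finset.sum_const_zero, add_zero]
    rfl
  | succ d ih =>
    obtain ⟨v, g, hg, rfl⟩ := exists_of_mem_polyFun_succ hf
    choose G hG hGx using fun k => ih (hg k)
    refine ⟨fun a => v + ∑ k, a k • G k a, ⟨?_, fun p q => ?_⟩, fun x => ?_⟩
    · refine (differentiable_const _).add (Differentiable.fun_sum fun k _ => ?_)
      exact (differentiable_apply k).smul (hG k).1
    · choose h hh hhz using fun k => (hG k).2 p q
      refine ⟨fun z => z ^ (d + 1) • v + ∑ k, (z ^ 2 * p k + q k) • h k z, ?_, fun z hz => ?_⟩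
      · refine Differentiable.add (by fun_prop) (Differentiable.fun_sum fun k _ => ?_)
        have := hh k
        fun_prop
      · simp only [hhz _ z hz, smul_add, Finset.smul_sum, smul_smul, Pi.add_apply, Pi.smul_apply,
          smul_eq_mul]
        congr 1
        refine Finset.sum_congr rfl fun k _ => ?_
        congr 1
        field_simp
        ring
    · simp only [hGx]
      rw [Submodule.coe_add, Pi.add_apply, Submodule.coe_sum, Finset.sum_apply]
      rfl

/-- With `z = e^{iθ}` the great circle is `z p + z⁻¹ q`, where `p, q = r (u ∓ i v) / 2`. The entire
function `z^d g` is bounded by `M` on the unit circle, hence on the disc, which contains `e^{iθ}`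
when `Im θ ≥ 0`; dividing by `|z|^d` gives the factor. Reversing `v` covers `Im θ < 0`. -/
theorem IsComplexPoly.norm_greatCircle_le (hr : 0 < r) {d : ℕ} {g : (Fin 3 → ℂ) → Spin n}
    (hg : IsComplexPoly d g) {M : ℝ}
    (hM : ∀ x ∈ Metric.sphere (0 : E3) r, ‖g (toComplex x)‖ ≤ M) {u v : E3} (hu : ‖u‖ = 1)
    (hv : ‖v‖ = 1) (huv : ⟪u, v⟫_ℝ = 0) (θ : ℂ) :
    ‖g (greatCircle r u v θ)‖ ≤ M * Real.exp (|θ.im|) ^ d := by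
  wlog hθ : 0 ≤ θ.im generalizing v θ
  · have := this (v := -v) (by rwa [norm_neg]) (by rw [inner_neg_right, huv, neg_zero]) (-θ)
      (by rw [Complex.neg_im]; linarith)
    rwa [greatCircle_neg, Complex.neg_im, abs_neg] at this
  obtain ⟨h, hh, hhz⟩ := hg.2 (fun k => r * ((u k : ℂ) - Complex.I * v k) / 2)
    (fun k => r * ((u k : ℂ) + Complex.I * v k) / 2)
  have hcirc : ∀ φ : ℂ, h (Complex.exp (φ * Complex.I)) =
      Complex.exp (φ * Complex.I) ^ d • g (greatCircle r u v φ) := fun φ => by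
    rw [hhz _ (Complex.exp_ne_zero _)]
    congr 2
    funext k
    simp only [greatCircle, Complex.cos, Complex.sin, Pi.add_apply, Pi.smul_apply, smul_eq_mul,
      ← Complex.exp_neg, neg_mul]
    ring
  have hle : ∀ z ∈ Metric.closedBall (0 : ℂ) 1, ‖h z‖ ≤ M := fun z hz => by
    have hz' : z ∈ closure (Metric.ball (0 : ℂ) 1) := by rwa [closure_ball _ one_ne_zero]
    refine Complex.norm_le_of_forall_mem_frontier_norm_le Metric.isBounded_ball hh.diffContOnCl
      (fun w hw => ?_) hz'
    rw [frontier_ball _ one_ne_zero, mem_sphere_zero_iff_norm] at hw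
    have hw' : w = Complex.exp (Complex.arg w * Complex.I) := by
      have := Complex.norm_mul_exp_arg_mul_I w
      rw [hw, Complex.ofReal_one, one_mul] at this
      exact this.symm
    rw [hw', hcirc, norm_smul, norm_pow, Complex.norm_exp_ofReal_mul_I, one_pow, one_mul,
      greatCircle_ofReal]
    exact hM _ (mem_sphere_greatCircle hr hu hv huv _)
  have hnorm : ‖Complex.exp (θ * Complex.I)‖ = Real.exp (-θ.im) := by
    rw [Complex.norm_exp]; simp
  have hz := hle (Complex.exp (θ * Complex.I)) (by
    rw [mem_closedBall_zero_iff, hnorm, Real.exp_le_one_iff]; linarith)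
  rw [hcirc, norm_smul, norm_pow, hnorm, Real.exp_neg, inv_pow, inv_mul_le_iff₀ (by positivity)] at hz
  rw [abs_of_nonneg hθ, mul_comm]
  exact hz

/-- A Bernstein-type inequality: Cauchy's estimate on the unit disc about a real angle, where `|Im
θ| ≤ 1`, bounds the derivative by `M e^d`. -/
theorem IsComplexPoly.norm_sub_le (hr : 0 < r) {d : ℕ} {g : (Fin 3 → ℂ) → Spin n}
    (hg : IsComplexPoly d g) {M : ℝ} (hM0 : 0 ≤ M)
    (hM : ∀ x ∈ Metric.sphere (0 : E3) r, ‖g (toComplex x)‖ ≤ M) {u v : E3} (hu : ‖u‖ = 1)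
    (hv : ‖v‖ = 1) (huv : ⟪u, v⟫_ℝ = 0) (θ : ℝ) :
    ‖g (greatCircle r u v θ) - g (greatCircle r u v 0)‖ ≤ M * Real.exp 1 ^ d * |θ| := by
  have hT : Differentiable ℂ fun θ => g (greatCircle r u v θ) :=
    hg.1.comp (differentiable_greatCircle u v)
  have hd : ∀ θ : ℝ, ‖deriv (fun θ => g (greatCircle r u v θ)) θ‖ ≤ M * Real.exp 1 ^ d := fun θ => by
    have := Complex.norm_deriv_le_of_forall_mem_sphere_norm_le (c := (θ : ℂ)) one_pos
      hT.diffContOnCl (C := M * Real.exp 1 ^ d) fun z hz => ?_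
    · simpa using this
    · refine (hg.norm_greatCircle_le hr hM hu hv huv z).trans ?_
      gcongr
      have h1 := Complex.abs_im_le_norm (z - θ)
      rw [mem_sphere_iff_norm.1 hz] at h1
      simpa using h1
  have hderiv : ∀ θ ∈ (Set.univ : Set ℝ), HasDerivWithinAt (fun θ : ℝ => g (greatCircle r u v θ))
      (deriv (fun θ => g (greatCircle r u v θ)) (θ : ℂ)) Set.univ θ := fun θ _ => by
    have := HasDerivAt.scomp θ (hT (θ : ℂ)).hasDerivAt Complex.ofRealCLM.hasDerivAt
    simp only [Complex.ofRealCLM_apply, Complex.ofReal_one, one_smul] at this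
    exact this.hasDerivWithinAt
  have := convex_univ.norm_image_sub_le_of_norm_hasDerivWithin_le hderiv (fun θ _ => hd θ)
    (Set.mem_univ 0) (Set.mem_univ θ)
  simpa using this

theorem norm_sq_restrict (f : SmoothFun n) :
    ‖restrict r f‖ ^ 2 = ∫ x : RealSphere r, ‖f.1 x‖ ^ 2 ∂surfaceMeasure r := by
  have h := inner_restrict (r := r) f f
  simp only [inner_self_eq_norm_sq_to_K] at h
  have h2 : ((‖restrict r f‖ ^ 2 : ℝ) : ℂ) =
      ((∫ x : RealSphere r, ‖f.1 x‖ ^ 2 ∂surfaceMeasure r : ℝ) : ℂ) := by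
    rw [← integral_complex_ofReal]
    push_cast
    exact h
  exact_mod_cast h2

/-- The supremum of a polynomial is bounded by its `L²` norm. -/
theorem exists_norm_le_restrict (hr : 0 < r) (n : ℕ) : ∃ K : ℝ, 0 < K ∧ ∀ d, ∀ f ∈ polyFun n (d + 1),
    ∀ x ∈ Metric.sphere (0 : E3) r, ‖f.1 x‖ ≤ K * Real.exp 2 ^ d * ‖restrict r f‖ := by
  obtain ⟨c, hc, hcap⟩ := exists_le_surfaceMeasure_ball hr
  refine ⟨Real.sqrt (4 / (c * (r / Real.pi) ^ 3)), by positivity, fun d f hf x hx => ?_⟩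
  obtain ⟨g, hg, hgf⟩ := exists_complexPoly hf
  have hfc : Continuous f.1 := (SmoothFun.contDiff f).continuous
  obtain ⟨x₀, hx₀, hmax⟩ := (isCompact_sphere (0 : E3) r).exists_isMaxOn ⟨x, hx⟩
    (hfc.norm.continuousOn)
  refine le_trans (hmax hx) ?_
  set M := ‖f.1 x₀‖ with hM
  have hM0 : 0 ≤ M := norm_nonneg _
  have hgM : ∀ x ∈ Metric.sphere (0 : E3) r, ‖g (toComplex x)‖ ≤ M := fun x hx => by
    rw [hgf]; exact hmax hx
  -- Points of this cap are at angle at most `e^{-d} / 2` from the maximum point, so the polynomial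
  -- drops by at most `M / 2` there.
  set ε := r / Real.pi * (Real.exp 1 ^ d)⁻¹ with hε
  have hε0 : 0 < ε := by positivity
  have hexp : (1 : ℝ) ≤ Real.exp 1 ^ d := one_le_pow₀ (Real.one_le_exp zero_le_one)
  have hεr : ε ≤ r := by
    have h1 : (Real.exp 1 ^ d)⁻¹ ≤ 1 := inv_le_one_of_one_le₀ hexp
    have h2 : r / Real.pi ≤ r := div_le_self hr.le (by linarith [Real.pi_gt_three])
    calc ε ≤ r * 1 := mul_le_mul h2 h1 (by positivity) hr.le
      _ = r := mul_one r
  have hlow : ∀ y : RealSphere r, y ∈ Metric.ball (⟨x₀, hx₀⟩ : RealSphere r) ε →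
      M ^ 2 / 4 ≤ ‖f.1 y‖ ^ 2 := fun y hy => by
    obtain ⟨u, v, θ, hu, hv, huv, hxu, hyu, hθ⟩ :=
      exists_arc hr (mem_sphere_zero_iff_norm.1 hx₀) (mem_sphere_zero_iff_norm.1 y.2)
    have h1 := hg.norm_sub_le hr hM0 hgM hu hv huv θ
    have h2 : greatCircle r u v 0 = toComplex x₀ := by
      rw [hxu]; simpa using greatCircle_ofReal (r := r) u v 0
    rw [greatCircle_ofReal, ← hyu, h2, hgf, hgf] at h1
    have h3 : ‖(y : E3) - x₀‖ ≤ ε := by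
      rw [← dist_eq_norm]; exact (Metric.mem_ball.1 hy).le
    have h4 : |θ| ≤ (Real.exp 1 ^ d)⁻¹ / 2 := by
      refine hθ.trans ?_
      calc Real.pi / (2 * r) * ‖(y : E3) - x₀‖ ≤ Real.pi / (2 * r) * ε := by gcongr
        _ = (Real.exp 1 ^ d)⁻¹ / 2 := by rw [hε]; field_simp
    have h5 : M * Real.exp 1 ^ d * |θ| ≤ M / 2 := by
      calc M * Real.exp 1 ^ d * |θ| ≤ M * Real.exp 1 ^ d * ((Real.exp 1 ^ d)⁻¹ / 2) := by gcongr
        _ = M / 2 := by field_simp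
    have h6 : M ≤ ‖f.1 y‖ + M / 2 := by
      have := norm_sub_norm_le (f.1 x₀) (f.1 y)
      rw [norm_sub_rev] at this
      linarith
    nlinarith [norm_nonneg (f.1 y)]
  have hint : Integrable (fun x : RealSphere r => ‖f.1 x‖ ^ 2) (surfaceMeasure r) :=
    (((hfc.comp continuous_subtype_val).norm).pow 2).integrable_of_hasCompactSupport
      (HasCompactSupport.of_compactSpace _)
  have hL2 : M ^ 2 / 4 * (c * ε ^ 3) ≤ ‖restrict r f‖ ^ 2 := by
    rw [norm_sq_restrict]
    calc M ^ 2 / 4 * (c * ε ^ 3) ≤ M ^ 2 / 4 *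
          (surfaceMeasure r).real (Metric.ball (⟨x₀, hx₀⟩ : RealSphere r) ε) := by
          gcongr; exact hcap _ _ hε0 hεr
      _ = ∫ x in Metric.ball (⟨x₀, hx₀⟩ : RealSphere r) ε, M ^ 2 / 4 ∂surfaceMeasure r := by
          rw [setIntegral_const, smul_eq_mul, mul_comm]
      _ ≤ ∫ x in Metric.ball (⟨x₀, hx₀⟩ : RealSphere r) ε, ‖f.1 x‖ ^ 2 ∂surfaceMeasure r :=
          setIntegral_mono_on (integrable_const _) hint.integrableOn
            Metric.isOpen_ball.measurableSet hlow
      _ ≤ _ := setIntegral_le_integral hint (Eventually.of_forall fun _ => by positivity)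
  refine abs_le_of_sq_le_sq' ?_ (by positivity) |>.2
  rw [mul_pow, mul_pow, Real.sq_sqrt (by positivity)]
  have h7 : M ^ 2 ≤ 4 / (c * (r / Real.pi) ^ 3) * (Real.exp 1 ^ d) ^ 3 * ‖restrict r f‖ ^ 2 := by
    have h8 : M ^ 2 = 4 / (c * (r / Real.pi) ^ 3) * (Real.exp 1 ^ d) ^ 3 *
        (M ^ 2 / 4 * (c * ε ^ 3)) := by
      rw [hε]; field_simp
    rw [h8]
    gcongr
  refine h7.trans ?_
  gcongr
  have h9 : Real.exp 2 = Real.exp 1 ^ 2 := by rw [← Real.exp_nat_mul]; norm_num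
  rw [h9, ← pow_mul, ← pow_mul, ← pow_mul]
  -- The cap costs `e^{3d}` in `M²`; enlarging it to `e^{4d}` makes the square root `(e²)^d`.
  exact pow_le_pow_right₀ (Real.one_le_exp zero_le_one) (by omega)

/-- The holomorphic extension of a polynomial to the complex sphere is controlled by its `L²` norm
on the sphere. -/
theorem exists_extension_bound (hr : 0 < r) (n : ℕ) : ∃ K A : ℝ, 0 < K ∧ 0 < A ∧
    ∀ d, ∀ f ∈ polyFun n (d + 1), ∃ g : (Fin 3 → ℂ) → Spin n, Differentiable ℂ g ∧
      (∀ x, g (toComplex x) = f.1 x) ∧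
      ∀ a ∈ complexSphere r, ‖g a‖ ≤ K * (A * ‖a‖) ^ d * ‖restrict r f‖ := by
  obtain ⟨K, hK, hsup⟩ := exists_norm_le_restrict hr n
  -- `e²` comes from the supremum bound, `4 / r` from `e^t ≤ 4 ‖a‖ / r`.
  refine ⟨K, Real.exp 2 * (4 / r), hK, by positivity, fun d f hf => ?_⟩
  obtain ⟨g, hg, hgf⟩ := exists_complexPoly hf
  refine ⟨g, hg.1, hgf, fun a ha => ?_⟩
  obtain ⟨u, v, t, hu, hv, huv, ht, hexp, rfl⟩ := exists_greatCircle hr ha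
  refine (hg.norm_greatCircle_le hr (fun x hx => by rw [hgf]; exact hsup d f hf x hx)
    hu hv huv _).trans ?_
  have h1 : ((t : ℂ) * Complex.I).im = t := by simp
  rw [h1, abs_of_nonneg ht, mul_assoc (Real.exp 2), mul_pow, ← mul_assoc K]
  rw [mul_right_comm]
  gcongr

end ComplexExtension

end MonopoleSphere

/-- Cauchy's estimate for the derivative of a holomorphic function of several variables. -/
theorem norm_fderiv_le_of_forall_mem_closedBall {E F : Type*} [NormedAddCommGroup E]
    [NormedSpace ℂ E] [NormedAddCommGroup F] [NormedSpace ℂ F] {f : E → F} {b : E} {δ C : ℝ}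
    (hδ : 0 < δ) (hf : ∀ x ∈ Metric.closedBall b δ, DifferentiableAt ℂ f x)
    (hC : ∀ x ∈ Metric.closedBall b δ, ‖f x‖ ≤ C) : ‖fderiv ℂ f b‖ ≤ C / δ := by
  have hC0 : 0 ≤ C := (norm_nonneg _).trans (hC b (Metric.mem_closedBall_self hδ.le))
  refine ContinuousLinearMap.opNorm_le_bound _ (by positivity) fun v => ?_
  by_cases hv : v = 0
  · simp [hv]
  have hv' : 0 < ‖v‖ := norm_pos_iff.2 hv
  have hmem : ∀ z ∈ Metric.closedBall (0 : ℂ) (δ / ‖v‖), b + z • v ∈ Metric.closedBall b δ :=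
    fun z hz => by
      rw [mem_closedBall_iff_norm, add_sub_cancel_left, norm_smul, ← le_div_iff₀ hv']
      exact mem_closedBall_zero_iff.1 hz
  have hline : ∀ z : ℂ, HasDerivAt (fun z : ℂ => b + z • v) v z := fun z => by
    simpa using ((hasDerivAt_id z).smul_const v).const_add b
  have hd : ∀ z ∈ Metric.closedBall (0 : ℂ) (δ / ‖v‖),
      HasDerivAt (fun z : ℂ => f (b + z • v)) (fderiv ℂ f (b + z • v) v) z := fun z hz =>
    (hf _ (hmem z hz)).hasFDerivAt.comp_hasDerivAt z (hline z)
  have hcl : DiffContOnCl ℂ (fun z : ℂ => f (b + z • v)) (Metric.ball 0 (δ / ‖v‖)) := by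
    refine DifferentiableOn.diffContOnCl fun z hz => ?_
    rw [closure_ball _ (by positivity)] at hz
    exact (hd z hz).differentiableAt.differentiableWithinAt
  have h := Complex.norm_deriv_le_of_forall_mem_sphere_norm_le (by positivity) hcl
    fun z hz => hC _ (hmem z (Metric.sphere_subset_closedBall hz))
  rw [(hd 0 (Metric.mem_closedBall_self (by positivity))).deriv] at h
  simp only [zero_smul, add_zero] at h
  exact h.trans_eq (by rw [div_div_eq_mul_div]; ring)

/-- Completing the square, `(log X + 1) d - β d² ≤ (log X + 1)² / (4β)`, so the terms are dominated
by a multiple of `e^{-d}`. -/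
theorem summable_exp_neg_sq_mul_pow {β X : ℝ} (hβ : 0 < β) (hX : 0 < X) :
    Summable fun d : ℕ => Real.exp (-(β * (d * (d + 1)))) * X ^ d := by
  refine Summable.of_nonneg_of_le (fun d => by positivity) (fun d => ?_)
    (Real.summable_exp_neg_nat.mul_left (Real.exp ((Real.log X + 1) ^ 2 / (4 * β))))
  have h1 : X ^ d = Real.exp (d * Real.log X) := by rw [Real.exp_nat_mul, Real.exp_log hX]
  rw [h1, ← Real.exp_add, ← Real.exp_add]
  refine Real.exp_le_exp.2 ?_
  have h2 : (Real.log X + 1) ^ 2 / (4 * β) - (Real.log X + 1) * d + β * d ^ 2 =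
      (Real.log X + 1 - 2 * β * d) ^ 2 / (4 * β) := by field_simp; ring
  have h3 : 0 ≤ (Real.log X + 1 - 2 * β * d) ^ 2 / (4 * β) := by positivity
  have h4 : 0 ≤ β * d := by positivity
  nlinarith

namespace MonopoleSphere

/-! ### Holomorphic maps on the complex sphere -/

section Holomorphic

variable {n : ℕ} {r : ℝ}

/-- The square of the complex Euclidean norm. -/
def complexNormSq (a : Fin 3 → ℂ) : ℂ := a 0 ^ 2 + a 1 ^ 2 + a 2 ^ 2

/-- The holomorphic retraction of a neighbourhood onto the complex sphere. -/
def retraction (r : ℝ) (a : Fin 3 → ℂ) : Fin 3 → ℂ :=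
  ((r : ℂ) * (complexNormSq a ^ (1 / 2 : ℂ))⁻¹) • a

theorem differentiable_complexNormSq : Differentiable ℂ complexNormSq := by
  unfold complexNormSq
  fun_prop

theorem retraction_mem {a : Fin 3 → ℂ} (ha : complexNormSq a ≠ 0) :
    retraction r a ∈ complexSphere r := by
  have h1 : (complexNormSq a ^ (1 / 2 : ℂ)) ^ 2 = complexNormSq a := by
    rw [one_div]; exact Complex.cpow_nat_inv_pow _ two_ne_zero
  have h2 : complexNormSq a ^ (1 / 2 : ℂ) ≠ 0 := fun h => ha (by rw [← h1, h]; simp)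
  change retraction r a 0 ^ 2 + retraction r a 1 ^ 2 + retraction r a 2 ^ 2 = _
  simp only [retraction, Pi.smul_apply, smul_eq_mul, mul_pow, inv_pow, h1]
  field_simp
  rfl

theorem retraction_of_mem (hr : 0 < r) {a : Fin 3 → ℂ} (ha : a ∈ complexSphere r) :
    retraction r a = a := by
  have h1 : complexNormSq a = (r : ℂ) ^ 2 := ha
  have h2 : (((r : ℂ) ^ 2) ^ (1 / 2 : ℂ)) = r := by
    rw [one_div, ← Complex.ofReal_pow]
    have : ((r ^ 2 : ℝ) : ℂ) ^ ((2 : ℂ)⁻¹) = (((r ^ 2 : ℝ) ^ ((2 : ℝ)⁻¹) : ℝ) : ℂ) := by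
      rw [Complex.ofReal_cpow (by positivity)]; norm_num
    rw [this, ← one_div, ← Real.sqrt_eq_rpow, Real.sqrt_sq hr.le]
  rw [retraction, h1, h2, mul_inv_cancel₀ (by exact_mod_cast hr.ne'), one_smul]

theorem differentiableAt_retraction {a : Fin 3 → ℂ} (ha : 0 < (complexNormSq a).re) :
    DifferentiableAt ℂ (retraction r) a := by
  have h0 : complexNormSq a ≠ 0 := fun h => by simp [h] at ha
  have h1 : DifferentiableAt ℂ (fun a => complexNormSq a ^ (1 / 2 : ℂ)) a :=
    (differentiable_complexNormSq a).cpow (differentiableAt_const _) (Or.inl ha)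
  have h2 : complexNormSq a ^ (1 / 2 : ℂ) ≠ 0 := by simp [Complex.cpow_eq_zero_iff, h0]
  exact ((h1.inv h2).const_mul (r : ℂ)).smul differentiableAt_id

/-- A series of entire functions with suitable bounds on the complex sphere converges to a
holomorphic map. -/
theorem isHolomorphic_tsum (hr : 0 < r) {G : ℕ → (Fin 3 → ℂ) → Spin n} {B : ℕ → ℝ → ℝ}
    (hG : ∀ d, Differentiable ℂ (G d)) (hB : ∀ R, 0 < R → Summable fun d => B d R)
    (hGB : ∀ d R, ∀ a ∈ complexSphere r, ‖a‖ ≤ R → ‖G d a‖ ≤ B d R) :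
    IsHolomorphic fun a : complexSphere r => ∑' d, G d a := by
  rintro ⟨a, ha⟩
  have hre : 0 < (complexNormSq a).re := by
    have h1 : complexNormSq a = ((r ^ 2 : ℝ) : ℂ) := by rw [Complex.ofReal_pow]; exact ha
    rw [h1, Complex.ofReal_re]
    positivity
  set R := ‖a‖ + 1 with hR
  have hRpos : 0 < R := by positivity
  have hev : ∀ᶠ b in 𝓝 a, 0 < (complexNormSq b).re ∧ ‖retraction r b‖ < R := by
    have hc : ContinuousAt (retraction r) a := (differentiableAt_retraction hre).continuousAt
    refine Filter.Eventually.and ?_ (hc.norm.eventually_lt_const ?_)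
    · exact (Complex.continuous_re.comp
        differentiable_complexNormSq.continuous).continuousAt.eventually_const_lt hre
    · change ‖retraction r a‖ < R
      rw [retraction_of_mem hr ha]; exact lt_add_one _
  obtain ⟨δ', hδ', hball⟩ := Metric.eventually_nhds_iff_ball.1 hev
  -- The bounds on `G d` hold only on the complex sphere, so the terms are composed with the
  -- retraction. Halving the radius leaves room for Cauchy's estimate around every point of the
  -- smaller ball, which permits termwise differentiation.
  set δ := δ' / 2 with hδdef
  have hδ : 0 < δ := half_pos hδ'
  have hsub : ∀ b ∈ Metric.ball a δ, ∀ x ∈ Metric.closedBall b δ, x ∈ Metric.ball a δ' :=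
    fun b hb x hx => by
      rw [Metric.mem_ball] at hb ⊢
      have := dist_triangle x b a
      rw [Metric.mem_closedBall] at hx
      linarith
  have hsub' : ∀ b ∈ Metric.ball a δ, b ∈ Metric.ball a δ' := fun b hb =>
    hsub b hb b (Metric.mem_closedBall_self hδ.le)
  have hmem : ∀ b ∈ Metric.ball a δ', retraction r b ∈ complexSphere r := fun b hb =>
    retraction_mem fun h => by have := (hball b hb).1; simp [h] at this
  have hdiff : ∀ d, ∀ b ∈ Metric.ball a δ', DifferentiableAt ℂ (fun b => G d (retraction r b)) b :=
    fun d b hb => (hG d _).comp b (differentiableAt_retraction (hball b hb).1)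
  have hbound : ∀ d, ∀ b ∈ Metric.ball a δ', ‖G d (retraction r b)‖ ≤ B d R := fun d b hb =>
    hGB d R _ (hmem b hb) (hball b hb).2.le
  refine ⟨Metric.ball a δ, Metric.isOpen_ball, Metric.mem_ball_self hδ,
    fun b => ∑' d, G d (retraction r b), fun b hb => ?_, fun b _ => ?_⟩
  · have h := hasFDerivAt_tsum_of_isPreconnected (𝕜 := ℂ) ((hB R hRpos).div_const δ)
      Metric.isOpen_ball (convex_ball a δ).isPreconnected
      (f := fun d b => G d (retraction r b))
      (f' := fun d b => fderiv ℂ (fun b => G d (retraction r b)) b)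
      (fun d b hb => (hdiff d b (hsub' b hb)).hasFDerivAt)
      (fun d b hb => norm_fderiv_le_of_forall_mem_closedBall hδ
        (fun x hx => hdiff d x (hsub b hb x hx)) fun x hx => hbound d x (hsub b hb x hx))
      (Metric.mem_ball_self hδ)
      (Summable.of_norm_bounded (hB R hRpos) fun d => hbound d a (Metric.mem_ball_self hδ')) hb
    exact h.differentiableAt.differentiableWithinAt
  · simp only [retraction_of_mem hr b.2]

theorem IsHolomorphic.differentiable_comp {F : complexSphere r → Spin n} (hF : IsHolomorphic F)
    {γ : ℂ → complexSphere r} (hγ : Differentiable ℂ fun z => (γ z : Fin 3 → ℂ)) :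
    Differentiable ℂ fun z => F (γ z) := by
  intro z
  obtain ⟨U, hU, hz, G, hG, hFG⟩ := hF (γ z)
  have h1 : DifferentiableAt ℂ (fun z => G (γ z : Fin 3 → ℂ)) z :=
    DifferentiableAt.comp z ((hG _ hz).differentiableAt (hU.mem_nhds hz)) (hγ z)
  refine h1.congr_of_eventuallyEq ?_
  filter_upwards [hγ.continuous.continuousAt.preimage_mem_nhds (hU.mem_nhds hz)] with w hw
  exact hFG _ hw

theorem IsHolomorphic.continuous {F : complexSphere r → Spin n} (hF : IsHolomorphic F) :
    Continuous F := by
  refine continuous_iff_continuousAt.2 fun a => ?_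
  obtain ⟨U, hU, ha, G, hG, hFG⟩ := hF a
  have h1 : ContinuousAt (fun b : complexSphere r => G b) a :=
    ContinuousAt.comp (x := a) ((hG.continuousOn).continuousAt (hU.mem_nhds ha))
      continuous_subtype_val.continuousAt
  refine h1.congr ?_
  filter_upwards [continuous_subtype_val.continuousAt.preimage_mem_nhds (hU.mem_nhds ha)] with b hb
  exact (hFG b hb).symm

theorem continuous_toComplex : Continuous toComplex :=
  continuous_pi fun k => (contDiff_coord k).continuous

theorem continuous_inclusion : Continuous (inclusion (r := r)) :=
  Continuous.subtype_mk (continuous_toComplex.comp continuous_subtype_val) _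

/-- The identity theorem: holomorphic maps on the complex sphere are determined by their
restrictions to the real sphere. -/
theorem IsHolomorphic.ext_real (hr : 0 < r) {F F' : complexSphere r → Spin n}
    (hF : IsHolomorphic F) (hF' : IsHolomorphic F')
    (h : ∀ x : RealSphere r, F (inclusion x) = F' (inclusion x)) : F = F' := by
  funext ⟨a, ha⟩
  obtain ⟨u, v, t, hu, hv, huv, -, -, rfl⟩ := exists_greatCircle hr ha
  let γ : ℂ → complexSphere r := fun θ => ⟨greatCircle r u v θ, greatCircle_mem hu hv huv θ⟩
  have hγ : Differentiable ℂ fun z => (γ z : Fin 3 → ℂ) := differentiable_greatCircle u v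
  have hreal : ∀ θ : ℝ, F (γ θ) = F' (γ θ) := fun θ => by
    have h1 : γ θ = inclusion ⟨_, mem_sphere_greatCircle hr hu hv huv θ⟩ :=
      Subtype.ext (greatCircle_ofReal u v θ)
    rw [h1, h]
  -- Along the great circle through `a` both maps are entire in `θ` and agree at real angles, which
  -- accumulate at `0`.
  have htend : Tendsto (fun θ : ℝ => (θ : ℂ)) (𝓝[≠] 0) (𝓝[≠] 0) := by
    refine tendsto_nhdsWithin_of_tendsto_nhds_of_eventually_within _ ?_ ?_
    · exact (Complex.continuous_ofReal.tendsto' 0 0 Complex.ofReal_zero).mono_left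
        nhdsWithin_le_nhds
    · filter_upwards [self_mem_nhdsWithin] with θ hθ
      exact Complex.ofReal_ne_zero.2 hθ
  have hfreq : ∃ᶠ z : ℂ in 𝓝[≠] 0, F (γ z) = F' (γ z) :=
    htend.frequently (Eventually.frequently (Eventually.of_forall hreal))
  have heq := AnalyticOnNhd.eq_of_frequently_eq
    (fun z _ => (hF.differentiable_comp hγ).analyticAt z)
    (fun z _ => (hF'.differentiable_comp hγ).analyticAt z) hfreq
  exact congrFun heq (t * Complex.I)

/-- Both maps are continuous and the surface measure charges every nonempty open set, so almost
everywhere equality on the sphere holds everywhere. -/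
theorem IsHolomorphic.ext_ae (hr : 0 < r) {F F' : complexSphere r → Spin n}
    (hF : IsHolomorphic F) (hF' : IsHolomorphic F')
    (h : ∀ᵐ x ∂surfaceMeasure r, F (inclusion x) = F' (inclusion x)) : F = F' := by
  have := isOpenPosMeasure_surfaceMeasure hr
  exact hF.ext_real hr hF' (congrFun (Measure.eq_of_ae_eq h
    (hF.continuous.comp continuous_inclusion) (hF'.continuous.comp continuous_inclusion)))

theorem differentiable_sigmaDot (ħ : ℝ) (n : ℕ) : Differentiable ℂ (sigmaDot ħ n) := by
  unfold sigmaDot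
  fun_prop

theorem IsHolomorphic.sigmaDot {F : complexSphere r → Spin n} (hF : IsHolomorphic F) (ħ : ℝ) :
    IsHolomorphic fun a : complexSphere r => sigmaDot ħ n a (F a) := by
  intro a
  obtain ⟨U, hU, ha, G, hG, hFG⟩ := hF a
  exact ⟨U, hU, ha, fun b => MonopoleSphere.sigmaDot ħ n b (G b),
    (differentiable_sigmaDot ħ n).differentiableOn.clm_apply hG, fun b hb => by
      simp only [hFG b hb]⟩

theorem IsHolomorphic.const_smul {F : complexSphere r → Spin n} (hF : IsHolomorphic F) (c : ℂ) :
    IsHolomorphic fun a => c • F a := by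
  intro a
  obtain ⟨U, hU, ha, G, hG, hFG⟩ := hF a
  exact ⟨U, hU, ha, fun b => c • G b, hG.const_smul c, fun b hb => by simp only [hFG b hb]⟩

end Holomorphic

end MonopoleSphere

namespace MonopoleSphere

/-! ### The Segal–Bargmann transform -/

section SegalBargmann

variable {n : ℕ} {r : ℝ}

/-- The graph of `Ĵ²` on smooth functions, as a subspace. -/
def smoothGraphSubmodule (r ħ : ℝ) (n : ℕ) : Submodule ℂ (L2 r n × L2 r n) :=
  LinearMap.range ((restrict (n := n) r).prod (restrict r ∘ₗ angularSqOp ħ))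

theorem smoothGraph_eq (r ħ : ℝ) (n : ℕ) :
    smoothGraph r ħ n = smoothGraphSubmodule r ħ n := by
  ext ⟨p, q⟩
  constructor
  · rintro ⟨f, hf, hp, hq⟩
    refine ⟨⟨f, mem_smoothFun hf⟩, Prod.ext (Lp.ext ?_) (Lp.ext ?_)⟩
    · filter_upwards [coeFn_restrict (r := r) ⟨f, mem_smoothFun hf⟩, hp] with x h1 h2
      exact h1.trans h2.symm
    · filter_upwards [coeFn_restrict (r := r) (angularSqOp ħ ⟨f, mem_smoothFun hf⟩), hq] with x h1 h2
      rw [angularSqOp_val] at h1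
      exact h1.trans h2.symm
  · rintro ⟨f, hf⟩
    obtain ⟨rfl, rfl⟩ := Prod.mk.inj hf
    refine ⟨f.1, SmoothFun.contDiff f, coeFn_restrict f, ?_⟩
    have h := coeFn_restrict (r := r) (angularSqOp ħ f)
    rw [angularSqOp_val] at h
    exact h

/-- Multiplication by `σ · x` on `L²`. -/
def sigmaMul (r ħ : ℝ) (n : ℕ) : L2 r n →L[ℂ] L2 r n :=
  (ContinuousLinearMap.id ℂ (Spin n →L[ℂ] Spin n)).holderL (surfaceMeasure r) ∞ 2 2
    (ContinuousMap.toLp ∞ (surfaceMeasure r) ℂ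
      ⟨fun x : RealSphere r => sigmaDot ħ n (toComplex x),
        (differentiable_sigmaDot ħ n).continuous.comp
          (continuous_toComplex.comp continuous_subtype_val)⟩)

theorem coeFn_sigmaMul (ħ : ℝ) (ψ : L2 r n) :
    ∀ᵐ x ∂surfaceMeasure r, sigmaMul r ħ n ψ x = sigmaDot ħ n (toComplex x.1) (ψ x) := by
  let s : C(RealSphere r, Spin n →L[ℂ] Spin n) :=
    ⟨fun x : RealSphere r => sigmaDot ħ n (toComplex x),
        (differentiable_sigmaDot ħ n).continuous.comp
          (continuous_toComplex.comp continuous_subtype_val)⟩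
  filter_upwards [ContinuousLinearMap.coeFn_holder (r := 2)
    (ContinuousLinearMap.id ℂ (Spin n →L[ℂ] Spin n))
    (ContinuousMap.toLp ∞ (surfaceMeasure r) ℂ s) ψ,
    ContinuousMap.coeFn_toLp (p := ∞) (𝕜 := ℂ) (surfaceMeasure r) s] with x h1 h2
  exact h1.trans (by rw [h2]; rfl)

theorem sigmaMul_restrict (ħ : ℝ) (f : SmoothFun n) :
    sigmaMul r ħ n (restrict r f) = restrict r (sigmaX ħ f) := by
  refine Lp.ext ?_
  filter_upwards [coeFn_sigmaMul ħ (restrict r f), coeFn_restrict (r := r) f,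
    coeFn_restrict (r := r) (sigmaX ħ f)] with x h1 h2 h3
  rw [h1, h2, h3, sigmaX_apply]

/-- Membership becomes an eigenvalue equation for a bounded operator, so it suffices that this
operator commutes with the flow. -/
theorem mem_schrodinger_iff (r ħ : ℝ) (k : ℤ) (ψ : L2 r k.natAbs) :
    ψ ∈ Schrodinger r ħ k ↔
      sigmaMul r ħ k.natAbs ψ = ((r * ħ * (k / 2) : ℝ) : ℂ) • ψ := by
  constructor
  · intro h
    have h' : ∀ᵐ x : RealSphere r ∂surfaceMeasure r,
      sigmaDot ħ k.natAbs (toComplex x.1) (ψ x) = ((r * ħ * (k / 2) : ℝ) : ℂ) • ψ x := h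
    refine Lp.ext ?_
    filter_upwards [h', coeFn_sigmaMul ħ ψ,
      Lp.coeFn_smul ((r * ħ * (k / 2) : ℝ) : ℂ) ψ] with x h1 h2 h3
    rw [h2, h3, Pi.smul_apply, h1]
  · intro h
    change ∀ᵐ x : RealSphere r ∂surfaceMeasure r,
      sigmaDot ħ k.natAbs (toComplex x.1) (ψ x) = ((r * ħ * (k / 2) : ℝ) : ℂ) • ψ x
    filter_upwards [coeFn_sigmaMul ħ ψ,
      Lp.coeFn_smul ((r * ħ * (k / 2) : ℝ) : ℂ) ψ] with x h2 h3
    rw [← h2, h, h3, Pi.smul_apply]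

/-- Multiplication by `σ · x` commutes with the heat flow. -/
theorem IsExpNegAngularSq.sigmaMul {ħ c : ℝ} {ψ Ψ : L2 r n} (h : IsExpNegAngularSq r ħ c ψ Ψ) :
    IsExpNegAngularSq r ħ c (sigmaMul r ħ n ψ) (sigmaMul r ħ n Ψ) := by
  obtain ⟨u, hc, rfl, rfl, hu⟩ := h
  set B := MonopoleSphere.sigmaMul r ħ n
  refine ⟨fun t => B (u t), B.continuous.comp_continuousOn hc, rfl, rfl, fun t ht => ?_⟩
  obtain ⟨w, hw, hd⟩ := hu t ht
  refine ⟨B w, ?_, ?_⟩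
  -- `B × B` is continuous and maps the smooth graph into itself, hence also its closure.
  · refine map_mem_closure (f := Prod.map B B) (by fun_prop) hw fun p hp => ?_
    rw [smoothGraph_eq] at hp ⊢
    obtain ⟨f, rfl⟩ := hp
    refine ⟨sigmaX ħ f, Prod.ext (sigmaMul_restrict ħ f).symm ?_⟩
    change restrict r (angularSqOp ħ (sigmaX ħ f)) = B (restrict r (angularSqOp ħ f))
    rw [angularSqOp_sigmaX, sigmaMul_restrict]
  · have h1 := (B.restrictScalars ℝ).hasFDerivAt.comp_hasDerivAt t hd
    refine h1.congr_deriv ?_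
    change B (-((c : ℂ) • w)) = _
    rw [map_neg, map_smul]

theorem norm_sum_orthonormal_le {H : Type*} [NormedAddCommGroup H] [InnerProductSpace ℂ H]
    {N : ℕ} {v : Fin N → H} (hv : Orthonormal ℂ v) {q : Fin N → ℝ} {C : ℝ} (hC : 0 ≤ C)
    (hq : ∀ i, |q i| ≤ C) (ψ : H) : ‖∑ i, ((q i : ℂ) * ⟪v i, ψ⟫_ℂ) • v i‖ ≤ C * ‖ψ‖ := by
  have h1 := hv.inner_sum (fun i => (q i : ℂ) * ⟪v i, ψ⟫_ℂ) (fun i => (q i : ℂ) * ⟪v i, ψ⟫_ℂ)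
    Finset.univ
  have h2 : ‖∑ i, ((q i : ℂ) * ⟪v i, ψ⟫_ℂ) • v i‖ ^ 2 =
      ∑ i, (|q i| * ‖⟪v i, ψ⟫_ℂ‖) ^ 2 := by
    have h3 : ((‖∑ i, ((q i : ℂ) * ⟪v i, ψ⟫_ℂ) • v i‖ ^ 2 : ℝ) : ℂ) =
        ((∑ i, (|q i| * ‖⟪v i, ψ⟫_ℂ‖) ^ 2 : ℝ) : ℂ) := by
      rw [inner_self_eq_norm_sq_to_K] at h1
      push_cast
      refine h1.trans (Finset.sum_congr rfl fun i _ => ?_)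
      rw [Complex.conj_mul', norm_mul, Complex.norm_real, Real.norm_eq_abs]
      push_cast
      rfl
    exact_mod_cast h3
  refine abs_le_of_sq_le_sq' ?_ (by positivity) |>.2
  rw [h2, mul_pow]
  calc ∑ i, (|q i| * ‖⟪v i, ψ⟫_ℂ‖) ^ 2 ≤ ∑ i, C ^ 2 * ‖⟪v i, ψ⟫_ℂ‖ ^ 2 := by
        refine Finset.sum_le_sum fun i _ => ?_
        rw [mul_pow]
        have := hq i
        gcongr
    _ ≤ C ^ 2 * ‖ψ‖ ^ 2 := by
        rw [← Finset.mul_sum]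
        gcongr
        exact hv.sum_inner_products_le ψ

/-- An `L²` function is almost everywhere the sum of a pointwise convergent series of smooth
functions which converges to it in `L²`. -/
theorem ae_eq_tsum_of_hasSum {φ : ℕ → SmoothFun n} {Ψ : L2 r n} {G : ℕ → RealSphere r → Spin n}
    (hφ : HasSum (fun d => restrict r (φ d)) Ψ) (hG : ∀ d x, G d x = (φ d).1 x.1)
    (hs : ∀ x, Summable fun d => G d x) : ∀ᵐ x ∂surfaceMeasure r, ∑' d, G d x = Ψ x := by
  -- `L²` convergence yields a subsequence of partial sums converging almost everywhere, whose limit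
  -- must be the pointwise sum.
  obtain ⟨ns, hns, hae⟩ :=
    (tendstoInMeasure_of_tendsto_Lp hφ.tendsto_sum_nat).exists_seq_tendsto_ae
  have hall : ∀ᵐ x ∂surfaceMeasure r, ∀ D : ℕ,
      restrict r (∑ d ∈ Finset.range D, φ d) x = (∑ d ∈ Finset.range D, φ d).1 x.1 :=
    ae_all_iff.2 fun D => coeFn_restrict _
  filter_upwards [hae, hall] with x h1 h2
  have h3 := ((hs x).hasSum.tendsto_sum_nat).comp hns.tendsto_atTop
  refine tendsto_nhds_unique h3 (h1.congr fun k => ?_)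
  rw [← map_sum, h2, Submodule.coe_sum, Finset.sum_apply]
  exact Finset.sum_congr rfl fun d _ => (hG d x).symm

/-- The heat flow of `Ĵ²` has a unique solution, which extends holomorphically to the complex
sphere at positive times. -/
theorem exists_heat_extension (hr : 0 < r) {ħ c : ℝ} (hħ : 0 < ħ) (hc : 0 < c) (ψ : L2 r n) :
    ∃ Ψ : L2 r n, IsExpNegAngularSq r ħ c ψ Ψ ∧
      (∀ Ψ', IsExpNegAngularSq r ħ c ψ Ψ' → Ψ' = Ψ) ∧
      (∀ μ : ℂ, sigmaMul r ħ n ψ = μ • ψ → sigmaMul r ħ n Ψ = μ • Ψ) ∧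
      ∃ F : complexSphere r → Spin n, IsHolomorphicExtension Ψ F := by
  obtain ⟨N, b, lam, f, C, hb⟩ := exists_eigenbasis hr ħ n
  have hG : ∀ i, (b i, (lam i : ℂ) • b i) ∈ smoothGraphSubmodule r ħ n := fun i =>
    ⟨f i, Prod.ext (hb i).2.1 (hb i).2.2.1⟩
  have hsymm : ∀ p ∈ smoothGraphSubmodule r ħ n, ∀ i, ⟪b i, p.2⟫_ℂ = lam i * ⟪b i, p.1⟫_ℂ := by
    rintro _ ⟨g, rfl⟩ i
    change ⟪b i, restrict r (angularSqOp ħ g)⟫_ℂ = lam i * ⟪b i, restrict r g⟫_ℂ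
    rw [← (hb i).2.1, ← inner_restrict_angularSqOp hr, (hb i).2.2.1, inner_smul_left,
      Complex.conj_ofReal, (hb i).2.1]
  have hcoeff : ∀ ψ Ψ, IsExpNegAngularSq r ħ c ψ Ψ → ∀ i,
      ⟪b i, Ψ⟫_ℂ = ((Real.exp (-(c * lam i)) : ℝ) : ℂ) * ⟪b i, ψ⟫_ℂ := fun ψ Ψ h => by
    rw [IsExpNegAngularSq, angularSqGraph, smoothGraph_eq] at h
    exact b.heat_coeff hsymm h
  obtain ⟨Ψ, hΨ⟩ := b.exists_heat (fun i => (hb i).2.2.2.1) hG hc ψ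
  have hΨ' : IsExpNegAngularSq r ħ c ψ Ψ := by
    rw [IsExpNegAngularSq, angularSqGraph, smoothGraph_eq]; exact hΨ
  have hΨc := hcoeff ψ Ψ hΨ'
  refine ⟨Ψ, hΨ', fun Ψ' h => b.ext_inner fun i => by rw [hcoeff _ _ h, hΨc], fun μ hμ =>
    b.ext_inner fun i => ?_, ?_⟩
  -- `(σ · x) Ψ` evolves from `(σ · x) ψ = μ ψ`, so its coefficients are `μ` times those of `Ψ`.
  · rw [hcoeff _ _ hΨ'.sigmaMul, hμ, inner_smul_right, inner_smul_right, hΨc]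
    ring
  obtain ⟨K, A, hK, hA, hext⟩ := exists_extension_bound hr n
  -- The degree-`d` block of the expansion of `Ψ`; the eigenvalue bound gives it Gaussian decay in
  -- `d`.
  let φ : ℕ → SmoothFun n := fun d => ∑ i : Fin (N d),
    (((Real.exp (-(c * lam ⟨d, i⟩)) : ℝ) : ℂ) * ⟪b ⟨d, i⟩, ψ⟫_ℂ) • f ⟨d, i⟩
  have hφmem : ∀ d, φ d ∈ polyFun n (d + 1) := fun d =>
    Submodule.sum_mem _ fun i _ => Submodule.smul_mem _ _ (hb ⟨d, i⟩).1
  have hφr : ∀ d, restrict r (φ d) = ∑ i : Fin (N d),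
      (((Real.exp (-(c * lam ⟨d, i⟩)) : ℝ) : ℂ) * ⟪b ⟨d, i⟩, ψ⟫_ℂ) • b ⟨d, i⟩ := fun d => by
    simp only [φ, map_sum, map_smul, (hb _).2.1]
  have hφsum : HasSum (fun d => restrict r (φ d)) Ψ := by
    have h1 := b.hasSum_repr Ψ
    refine h1.sigma fun d => ?_
    rw [hφr]
    simp only [b.repr_apply_apply, hΨc]
    exact hasSum_fintype _
  have hφnorm : ∀ d, ‖restrict r (φ d)‖ ≤
      Real.exp (c * C) * Real.exp (-(c * ħ ^ 2 / 2 * (d * (d + 1)))) * ‖ψ‖ := fun d => by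
    rw [hφr]
    refine norm_sum_orthonormal_le (b.orthonormal.comp (Sigma.mk d) sigma_mk_injective)
      (by positivity) (fun i => ?_) ψ
    rw [Real.abs_exp, ← Real.exp_add, Real.exp_le_exp]
    have := mul_le_mul_of_nonneg_left (hb ⟨d, i⟩).2.2.2.2 hc.le
    linarith
  choose G hGd hGf hGb using fun d => hext d (φ d) (hφmem d)
  set Bd : ℕ → ℝ → ℝ := fun d R => (K * Real.exp (c * C) * ‖ψ‖) *
    (Real.exp (-(c * ħ ^ 2 / 2 * (d * (d + 1)))) * (A * R) ^ d) with hBd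
  have hBs : ∀ R, 0 < R → Summable fun d => Bd d R := fun R hR =>
    (summable_exp_neg_sq_mul_pow (by positivity) (mul_pos hA hR)).mul_left _
  have hGB : ∀ d R, ∀ a ∈ complexSphere r, ‖a‖ ≤ R → ‖G d a‖ ≤ Bd d R := fun d R a ha haR => by
    refine (hGb d a ha).trans ?_
    calc K * (A * ‖a‖) ^ d * ‖restrict r (φ d)‖ ≤ K * (A * R) ^ d *
          (Real.exp (c * C) * Real.exp (-(c * ħ ^ 2 / 2 * (d * (d + 1)))) * ‖ψ‖) := by
          have := hφnorm d
          have := (norm_nonneg a).trans haR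
          gcongr
      _ = Bd d R := by rw [hBd]; ring
  refine ⟨fun a => ∑' d, G d a, isHolomorphic_tsum hr hGd hBs hGB, ?_⟩
  refine ae_eq_tsum_of_hasSum (G := fun d x => G d (inclusion x).1) hφsum
    (fun d x => hGf d x.1) fun x => ?_
  refine Summable.of_norm_bounded (hBs (‖(inclusion x).1‖ + 1) (by positivity)) fun d => ?_
  exact hGB d _ _ (inclusion x).2 (lt_add_one _).le

end SegalBargmann

end MonopoleSphere

end

/-! ### The Segal–Bargmann transform theorem -/

open MonopoleSphere
theorem mainTheorem5 (r m α ħ : ℝ) (hr : 0 < r) (hm : 0 < m) (hα : 0 < α) (hħ : 0 < ħ)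
    (k : ℤ) (ψ : L2 r k.natAbs) (hψ : ψ ∈ Schrodinger r ħ k) :
    ∃ Ψ : L2 r k.natAbs,
      IsExpNegAngularSq r ħ (1 / (2 * m * α * r ^ 2 * ħ)) ψ Ψ ∧
      (∀ Ψ' : L2 r k.natAbs,
        IsExpNegAngularSq r ħ (1 / (2 * m * α * r ^ 2 * ħ)) ψ Ψ' → Ψ' = Ψ) ∧
      Ψ ∈ Schrodinger r ħ k ∧
      ∃ F : complexSphere r → Spin k.natAbs,
        IsHolomorphicExtension Ψ F ∧
        (∀ F' : complexSphere r → Spin k.natAbs, IsHolomorphicExtension Ψ F' → F' = F) ∧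
        F ∈ HolomorphicSections r ħ k := by
  obtain ⟨Ψ, hΨ, huniq, hsec, F, hF⟩ := exists_heat_extension (n := k.natAbs) hr hħ
    (show 0 < 1 / (2 * m * α * r ^ 2 * ħ) by positivity) ψ
  have hΨS : Ψ ∈ Schrodinger r ħ k :=
    (mem_schrodinger_iff r ħ k Ψ).2 (hsec _ ((mem_schrodinger_iff r ħ k ψ).1 hψ))
  refine ⟨Ψ, hΨ, huniq, hΨS, F, hF, fun F' hF' => ?_, hF.1, fun a => ?_⟩
  · refine hF'.1.ext_ae hr hF.1 ?_
    filter_upwards [hF.2, hF'.2] with x h1 h2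
    rw [h1, h2]
  -- Both sides of the equation are holomorphic in `a` and agree almost everywhere on the real
  -- sphere, so the identity theorem applies.
  · refine congrFun ((hF.1.sigmaDot ħ).ext_ae hr
      (hF.1.const_smul ((r * ħ * (k / 2) : ℝ) : ℂ)) ?_) a
    have h : ∀ᵐ x : RealSphere r ∂surfaceMeasure r,
      sigmaDot ħ k.natAbs (toComplex x.1) (Ψ x) = ((r * ħ * (k / 2) : ℝ) : ℂ) • Ψ x := hΨS
    filter_upwards [hF.2, h] with x h1 h2
    rw [h1]
    exact h2
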